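/- Let $\Gamma$ be a regular rooted metric tree with root $o$: all vertices of generation $n=0,1,\dots$ have the same branching number $b_n$ (the number of edges emanating upwards), with $b_0=1$ and $1<b_n<\infty$ for $n\ge1$, and lie at the same distance $t_n$ from the root, where $0=t_0<t_1<t_2<\cdots$ is unbounded. Let $|x|$ be the distance of $x\in\Gamma$ from $o$ and $dx$ the measure induced by Lebesgue measure on the edges, let $g_0(s)=b_0b_1\cdots b_n$ for $t_n<s\le t_{n+1}$, let $l(\Gamma)=\int_0^\infty ds/g_0(s)$ be the reduced height, and let $e_0$ be the edge emanating from the root, of length $t_1$. Functions are complex-valued. $H^1(\Gamma)$ is the space of continuous functions $u$ on $\Gamma$ with $u|_e\in H^1(e)$ for every edge $e$ and $u,u'\in L_2(\Gamma)$, and $H^{1,0}(\Gamma)=\{u\in H^1(\Gamma):u(o)=0\}$. $\mathcal H^{1,0}(\Gamma)$ is the space of continuous $u$ with $u(o)=0$, $u|_e\in H^1(e)$ for every edge $e$ and $u'\in L_2(\Gamma)$, with the norm $\|u'\|_{L_2(\Gamma)}$, and $\mathcal H^\circ(\Gamma)$ is the closure of $H^{1,0}(\Gamma)$ in it. The tree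 is called transient if $\mathcal H^\circ(\Gamma)\ne\mathcal H^{1,0}(\Gamma)$. For a transient $\Gamma$ let $\mathcal H(\Gamma)$ be the completion of $H^1(\Gamma)$ in the norm $\|u'\|_{L_2(\Gamma)}$, which is a space of continuous functions on $\Gamma$ (the pointwise limits of the Cauchy sequences). For $V\ge0$ such that the quadratic form $\mathbf a_V[u]=\int_\Gamma V|u|^2dx$ is bounded on $\mathcal H^\circ(\Gamma)$ (respectively on $\mathcal H(\Gamma)$), let $\mathbf A^\circ_V$ (respectively $\widetilde{\mathbf A}_V$) be the bounded self-adjoint operator that it generates in this Hilbert space. For $0<p<\infty$, a compact operator $\mathbf A$ with singular numbers $s_1(\mathbf A)\ge s_2(\mathbf A)\ge\cdots$ (counted with multiplicity) belongs to $\mathcal C_p$ if $\|\mathbf A\|_{p}=(\sum_n s_n(\mathbf A)^p)^{1/p}<\infty$, to $\mathcal C_{p,w}$ if $\|\mathbf A\|_{p,w}=\sup_n n^{1/p}s_n(\mathbf A)<\infty$, and to $\mathcal C^\circ_{p,w}$ (with the quasi-norm $\|\cdot\|_{p,w}$) if $s_n(\mathbf A)=o(n^{-1/p})$. **Theorem.**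 Let $\Gamma$ be a transient regular tree and let $V\in L_1(\Gamma)$, $V\ge0$, be such that $\mathbf a_V$ is bounded on $\mathcal H^\circ(\Gamma)$. Then $\mathbf a_V$ is bounded on $\mathcal H(\Gamma)$. Moreover, if $\mathbf A^\circ_V$ belongs to $\mathcal C$, where $\mathcal C$ is one of $\mathcal C_p$, $\mathcal C_{p,w}$, $\mathcal C^\circ_{p,w}$ with some $p\in(0,\infty)$, then $\widetilde{\mathbf A}_V$ belongs to the same class $\mathcal C$ and $$\|\widetilde{\mathbf A}_V\|_{\mathcal C}\le C\Bigl(\|\mathbf A^\circ_V\|_{\mathcal C}+t_1\int_{e_0}V\,dx\Bigr),$$ where the constant $C$ depends only on $l(\Gamma)$ and $t_1$. -/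

import Mathlib

open MeasureTheory Filter Topology
open scoped ComplexConjugate

noncomputable section

/-- The data of a regular (radial) rooted metric tree: `b n` is the branching number of every vertex
of generation `n` and `t n` is the distance of these vertices from the root. -/
structure RegularTree where
  /-- branching numbers -/
  b : ℕ → ℕ
  /-- heights of the vertices -/
  t : ℕ → ℝ
  b_zero : b 0 = 1
  one_lt_b : ∀ n, n ≠ 0 → 1 < b n
  t_zero : t 0 = 0
  t_strictMono : StrictMono t
  t_unbounded : ∀ M : ℝ, ∃ n, M < t n

namespace RegularTree

/-- A point of the metric tree `Γ`: its distance `|x|` from the root, together with the branch chosen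
at each vertex strictly below it (one for each generation `i` with `t i < |x|`). -/
@[ext]
structure Point (T : RegularTree) where
  /-- the distance from the root -/
  height : ℝ
  height_nonneg : 0 ≤ height
  /-- the branch chosen at the vertex of generation `i` lying strictly below the point -/
  branch : ∀ i : ℕ, T.t i < height → Fin (T.b i)

/-- The root `o`. -/
def root (T : RegularTree) : T.Point where
  height := 0
  height_nonneg := le_rfl
  branch i hi := absurd hi (not_lt.mpr (T.t_zero ▸ T.t_strictMono.monotone (Nat.zero_le i)))

/-- An edge joining a vertex of generation `n` to one of generation `n + 1`, given by `n` and the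
branches chosen at the vertices of generations `0, …, n` on the way up. There are
`b 0 * ⋯ * b n` of them. -/
def Edge (T : RegularTree) : Type := Σ n : ℕ, ∀ i : Fin (n + 1), Fin (T.b i)

/-- For an edge `e` of generation `n` and `s ∈ [t n, t (n+1)]`: the point of (the closed edge) `e`
at distance `s` from the root. (For `s ∈ [0, t n]` it is the point at height `s` on the path from the
root to `e`; other values of `s` are clamped to `[0, t (n+1)]`.) -/
def pt (T : RegularTree) (e : T.Edge) (s : ℝ) : T.Point where
  height := max 0 (min s (T.t (e.1 + 1)))
  height_nonneg := le_max_left _ _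
  branch i hi := e.2 ⟨i, by
    have h0 : 0 ≤ T.t i := T.t_zero ▸ T.t_strictMono.monotone (Nat.zero_le i)
    rcases lt_max_iff.mp hi with h | h
    · exact absurd h (not_lt.mpr h0)
    · exact T.t_strictMono.lt_iff_lt.mp (lt_of_lt_of_le h (min_le_right _ _))⟩

/-- The parameter interval of a closed edge. -/
def edgeIcc (T : RegularTree) (e : T.Edge) : Set ℝ := Set.Icc (T.t e.1) (T.t (e.1 + 1))

/-- A subset of `Γ` is measurable if its trace on every edge is a Borel set. -/
instance instMeasurableSpacePoint (T : RegularTree) : MeasurableSpace T.Point :=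
  ⨅ e : T.Edge, (borel ℝ).map (T.pt e)

/-- The natural measure `dx` on `Γ`, induced by Lebesgue measure on the edges. -/
def measure (T : RegularTree) : Measure T.Point :=
  Measure.sum fun e : T.Edge => (volume.restrict (T.edgeIcc e)).map (T.pt e)

/-- For `s > 0`, the number `n` with `t n < s ≤ t (n + 1)`. -/
def gen (T : RegularTree) (s : ℝ) : ℕ := sInf {n | s ≤ T.t (n + 1)}

/-- The branching function `g₀(s) = b 0 * ⋯ * b n` for `t n < s ≤ t (n + 1)`. -/
def g₀ (T : RegularTree) (s : ℝ) : ℝ := ∏ i ∈ Finset.range (T.gen s + 1), (T.b i : ℝ)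

/-- The reduced height `l(Γ) = ∫₀^∞ ds / g₀(s)`. -/
def reducedHeight (T : RegularTree) : ℝ := ∫ s in Set.Ioi (0 : ℝ), 1 / T.g₀ s

/-- The edge `e₀` emanating from the root, as a subset of `Γ` (there is just one as `b 0 = 1`). -/
def rootEdge (T : RegularTree) : Set T.Point := {x | x.height ≤ T.t 1}

lemma measurable_pt (T : RegularTree) (e : T.Edge) : Measurable (T.pt e) := by
  intro s hs
  rw [BorelSpace.measurable_eq (α := ℝ)]
  exact (MeasurableSpace.measurableSet_iInf.mp hs) e

lemma map_pt_le_measure (T : RegularTree) (e : T.Edge) :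
    (volume.restrict (T.edgeIcc e)).map (T.pt e) ≤ T.measure :=
  Measure.le_sum (fun e : T.Edge => (volume.restrict (T.edgeIcc e)).map (T.pt e)) e

lemma ae_pt (T : RegularTree) (e : T.Edge) {P : T.Point → Prop} (h : ∀ᵐ x ∂T.measure, P x) :
    ∀ᵐ s ∂(volume.restrict (T.edgeIcc e)), P (T.pt e s) :=
  ae_of_ae_map (T.measurable_pt e).aemeasurable ((T.map_pt_le_measure e).absolutelyContinuous h)

lemma integrableOn_pt (T : RegularTree) (e : T.Edge) (w : Lp ℂ 2 T.measure) :
    IntegrableOn (fun s => w (T.pt e s)) (T.edgeIcc e) := by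
  have h := ((Lp.memLp w).mono_measure (T.map_pt_le_measure e)).comp_of_map
    (T.measurable_pt e).aemeasurable
  have : IsFiniteMeasure (volume.restrict (T.edgeIcc e)) :=
    ⟨by simp [edgeIcc, Real.volume_Icc]⟩
  exact h.integrable (by norm_num)

lemma intervalIntegrable_pt (T : RegularTree) (e : T.Edge) (w : Lp ℂ 2 T.measure) {r s : ℝ}
    (hr : r ∈ T.edgeIcc e) (hs : s ∈ T.edgeIcc e) :
    IntervalIntegrable (fun τ => w (T.pt e τ)) volume r s :=
  ((T.integrableOn_pt e w).mono_set (Set.ordConnected_Icc.uIcc_subset hr hs)).intervalIntegrable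

lemma integral_pt_congr (T : RegularTree) (e : T.Edge) {f g : T.Point → ℂ} (h : f =ᵐ[T.measure] g)
    {r s : ℝ} (hr : r ∈ T.edgeIcc e) (hs : s ∈ T.edgeIcc e) :
    ∫ τ in r..s, f (T.pt e τ) = ∫ τ in r..s, g (T.pt e τ) := by
  apply intervalIntegral.integral_congr_ae_restrict
  exact ae_restrict_of_ae_restrict_of_subset
    (Set.uIoc_subset_uIcc.trans (Set.ordConnected_Icc.uIcc_subset hr hs)) (T.ae_pt e h)

/-- Pairs `(u, w)` of a function `u` on `Γ` and `w ∈ L₂(Γ)` such that on each closed edge `u` is the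
integral of `w`, that is, `u` is absolutely continuous on every closed edge and `u' = w`. Adjacent
closed edges share their common vertex, so that `u` is automatically continuous on `Γ`. -/
def dirichletPairs (T : RegularTree) : Submodule ℂ ((T.Point → ℂ) × Lp ℂ 2 T.measure) where
  carrier := {p | ∀ e : T.Edge, ∀ r ∈ T.edgeIcc e, ∀ s ∈ T.edgeIcc e,
    p.1 (T.pt e s) - p.1 (T.pt e r) = ∫ τ in r..s, p.2 (T.pt e τ)}
  zero_mem' := by
    intro e r hr s hs
    rw [Prod.snd_zero, T.integral_pt_congr e (Lp.coeFn_zero ℂ 2 T.measure) hr hs]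
    simp
  add_mem' := by
    intro p q hp hq e r hr s hs
    rw [Prod.snd_add, T.integral_pt_congr e (Lp.coeFn_add p.2 q.2) hr hs]
    simp only [Pi.add_apply, Prod.fst_add]
    rw [intervalIntegral.integral_add (T.intervalIntegrable_pt e p.2 hr hs)
      (T.intervalIntegrable_pt e q.2 hr hs), ← hp e r hr s hs, ← hq e r hr s hs]
    ring
  smul_mem' := by
    intro c p hp e r hr s hs
    rw [Prod.smul_snd, T.integral_pt_congr e (Lp.coeFn_smul c p.2) hr hs]
    simp only [Pi.smul_apply, Prod.smul_fst, smul_eq_mul]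
    rw [intervalIntegral.integral_const_mul, ← hp e r hr s hs]
    ring

/-- All continuous functions `u` on `Γ` with `u|e ∈ H¹(e)` for each edge `e` and `u' ∈ L₂(Γ)`
(every edge is bounded, so that `u|e ∈ L₂(e)` holds anyway). -/
def DirichletSpace (T : RegularTree) : Type := T.dirichletPairs

instance (T : RegularTree) : AddCommGroup T.DirichletSpace :=
  inferInstanceAs (AddCommGroup T.dirichletPairs)

instance (T : RegularTree) : Module ℂ T.DirichletSpace :=
  inferInstanceAs (Module ℂ T.dirichletPairs)

/-- The values of `u`. -/
def fn (T : RegularTree) : T.DirichletSpace →ₗ[ℂ] (T.Point → ℂ) :=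
  (LinearMap.fst ℂ (T.Point → ℂ) (Lp ℂ 2 T.measure)).comp T.dirichletPairs.subtype

/-- The derivative `u'`. -/
def der (T : RegularTree) : T.DirichletSpace →ₗ[ℂ] Lp ℂ 2 T.measure :=
  (LinearMap.snd ℂ (T.Point → ℂ) (Lp ℂ 2 T.measure)).comp T.dirichletPairs.subtype

/-- The (semi)norm `‖u'‖` in `L₂(Γ)`. -/
instance (T : RegularTree) : SeminormedAddCommGroup T.DirichletSpace :=
  SeminormedAddCommGroup.induced T.DirichletSpace (Lp ℂ 2 T.measure) T.der

/-- The inner product `∫ u' conj(v') dx` (conjugate-linear in the first argument, following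
Mathlib's convention). -/
instance (T : RegularTree) : InnerProductSpace ℂ T.DirichletSpace where
  norm_smul_le c u := by
    change ‖T.der (c • u)‖ ≤ ‖c‖ * ‖T.der u‖
    rw [map_smul, norm_smul]
  inner u v := inner ℂ (T.der u) (T.der v)
  norm_sq_eq_re_inner u := norm_sq_eq_re_inner (𝕜 := ℂ) (T.der u)
  conj_inner_symm u v := inner_conj_symm (T.der u) (T.der v)
  add_left u v w := by rw [map_add]; exact inner_add_left _ _ _
  smul_left u v c := by rw [map_smul]; exact inner_smul_left _ _ _

/-- The Sobolev space `H¹(Γ)`: those `u` which in addition lie in `L₂(Γ)`. -/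
def H1 (T : RegularTree) : Submodule ℂ T.DirichletSpace where
  carrier := {u | MemLp (T.fn u) 2 T.measure}
  zero_mem' := by
    change MemLp (T.fn 0) 2 T.measure
    rw [map_zero]; exact MemLp.zero
  add_mem' {u v} hu hv := by
    change MemLp (T.fn (u + v)) 2 T.measure
    rw [map_add]; exact MemLp.add hu hv
  smul_mem' c u hu := by
    change MemLp (T.fn (c • u)) 2 T.measure
    rw [map_smul]; exact MemLp.const_smul hu c

/-- The homogeneous Sobolev space `𝓗^{1,0}(Γ)`, given by the condition `u(o) = 0`. -/
def homH10 (T : RegularTree) : Submodule ℂ T.DirichletSpace :=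
  LinearMap.ker ((LinearMap.proj T.root).comp T.fn)

/-- The Sobolev space `H^{1,0}(Γ)`: those `u ∈ H¹(Γ)` with `u(o) = 0`. -/
def H10 (T : RegularTree) : Submodule ℂ T.DirichletSpace := T.H1 ⊓ T.homH10

/-- The space `𝓗°(Γ)`: the closure of `H^{1,0}(Γ)` in `𝓗^{1,0}(Γ)` with respect to `‖u'‖`. -/
def homH0 (T : RegularTree) : Submodule ℂ T.DirichletSpace :=
  T.homH10 ⊓ T.H10.topologicalClosure

/-- The tree is transient if `H^{1,0}(Γ)` is not dense in `𝓗^{1,0}(Γ)`. -/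
def IsTransient (T : RegularTree) : Prop := T.homH0 ≠ T.homH10

/-- The full homogeneous space `𝓗(Γ)`: the completion of `H¹(Γ)` in the norm `‖u'‖`, realized as a
space of functions on a transient tree. There `|u(o)| ≤ const * ‖u'‖` on `H¹(Γ)`, so that a sequence in
`H¹(Γ)` that is Cauchy for `‖u'‖` converges pointwise; the element of the completion that it defines
is identified with its pointwise limit. -/
def homH (T : RegularTree) : Submodule ℂ T.DirichletSpace where
  carrier := {u | ∃ q : ℕ → T.DirichletSpace, (∀ n, q n ∈ T.H1) ∧ Tendsto q atTop (𝓝 u) ∧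
    ∀ x, Tendsto (fun n => T.fn (q n) x) atTop (𝓝 (T.fn u x))}
  zero_mem' := ⟨fun _ => 0, fun _ => T.H1.zero_mem, tendsto_const_nhds,
    fun _ => tendsto_const_nhds⟩
  add_mem' := by
    rintro u v ⟨q, hq, hqu, hqx⟩ ⟨r, hr, hrv, hrx⟩
    refine ⟨fun n => q n + r n, fun n => T.H1.add_mem (hq n) (hr n), hqu.add hrv, fun x => ?_⟩
    simp only [map_add, Pi.add_apply]
    exact (hqx x).add (hrx x)
  smul_mem' := by
    rintro c u ⟨q, hq, hqu, hqx⟩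
    refine ⟨fun n => c • q n, fun n => T.H1.smul_mem c (hq n), hqu.const_smul c, fun x => ?_⟩
    simp only [map_smul, Pi.smul_apply]
    exact (hqx x).const_smul c

/-- `A` is the bounded operator generated in the space `S` by the quadratic form
`∫ V |u|² dx` (in particular, this form is finite on `S`): `(A u, u) = ∫ V |u|² dx` for all `u ∈ S`.
The scalars are complex, so that this determines `A` and makes it self-adjoint. -/
def IsFormOperator (T : RegularTree) (V : T.Point → ℝ) {S : Submodule ℂ T.DirichletSpace}
    (A : S →L[ℂ] S) : Prop :=
  ∀ u : S, Integrable (fun x => V x * ‖T.fn u x‖ ^ 2) T.measure ∧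
    inner ℂ (A u) u = ((∫ x, V x * ‖T.fn u x‖ ^ 2 ∂T.measure : ℝ) : ℂ)

end RegularTree

section OperatorClasses

variable {E : Type*} [SeminormedAddCommGroup E] [InnerProductSpace ℂ E]

/-- The singular numbers `s₀(A) ≥ s₁(A) ≥ …` of an operator in a Hilbert space, counted according to
multiplicity (and from `0`): `sₙ(A)` is the distance of `A` from the operators of rank at most `n`. -/
def singularNumber (A : E →L[ℂ] E) (n : ℕ) : ℝ :=
  sInf {r : ℝ | ∃ F : E →L[ℂ] E, (F : E →ₗ[ℂ] E).rank ≤ (n : Cardinal) ∧ r = ‖A - F‖}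

/-- The Schatten class `C_p`. -/
def MemSchatten (p : ℝ) (A : E →L[ℂ] E) : Prop :=
  IsCompactOperator A ∧ Summable fun n => singularNumber A n ^ p

/-- The (quasi-)norm in `C_p`. -/
def schattenNorm (p : ℝ) (A : E →L[ℂ] E) : ℝ := (∑' n, singularNumber A n ^ p) ^ (1 / p)

/-- The weak Schatten class `C_{p,w}`: `sₙ(A) = O(n^{-1/p})`. -/
def MemWeakSchatten (p : ℝ) (A : E →L[ℂ] E) : Prop :=
  IsCompactOperator A ∧
    BddAbove (Set.range fun n : ℕ => ((n : ℝ) + 1) ^ (1 / p) * singularNumber A n)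

/-- The quasi-norm in `C_{p,w}`. -/
def weakSchattenNorm (p : ℝ) (A : E →L[ℂ] E) : ℝ :=
  ⨆ n : ℕ, ((n : ℝ) + 1) ^ (1 / p) * singularNumber A n

/-- The class `C°_{p,w}`: `sₙ(A) = o(n^{-1/p})`, with the quasi-norm of `C_{p,w}`. -/
def MemWeakSchattenZero (p : ℝ) (A : E →L[ℂ] E) : Prop :=
  IsCompactOperator A ∧
    Tendsto (fun n : ℕ => ((n : ℝ) + 1) ^ (1 / p) * singularNumber A n) atTop (𝓝 0)

end OperatorClasses

end

noncomputable section

/-! ### Singular numbers as approximation numbers -/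

section SingularNumbers

section Seminormed

variable {E : Type*} [SeminormedAddCommGroup E] [InnerProductSpace ℂ E]

/-! The space `homH0` has codimension one in `homH`: if `η ∈ H1` equals `1` at the root and lives on
the root edge, then `u - u(o) η` lies in `homH0` for every `u ∈ homH`. The form operator on the
larger space is therefore a rank-one enlargement of the given one, which shifts singular numbers by
one index.

For this, `u(o)` must be controlled by the norm. If the reduced height were infinite, a unit of flux
through an edge could be spread over the tree above it at arbitrarily small energy, so derivatives
of functions from `H10` would be dense in `L₂` and the tree would not be transient
(`setIntegral_eq_zero_of_orthogonal`, `IsTransient.integrableOn`). If it is finite, Cauchy–Schwarz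
against `1 / g₀` bounds the oscillation of level averages, and square integrability excludes
averages bounded away from zero; hence `|u(o)| ≤ √l ‖u'‖` (`norm_fn_root_le`). So `homH` is a
Hilbert space of functions (`completeSpace_homH`), and splitting off `u(o) η` bounds the form there
(`IsFormOperator.form_le`). The new operator is `A' = J* J`, where `J` is multiplication by `√V`.

An approximant `F` of `A` with rank at most `n`, together with evaluation at the root, imposes at
most `n + 1` independent conditions, under which the form is at most `‖A - F‖ ‖u‖²`. Hence
`s_{n+1}(A') ≤ s_n(A)` (`IsFormOperator.singularNumber_succ_le`), while `s_0(A')` is bounded by the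
form estimate.

The shift costs a factor `2^(1/p)`, whereas the constant may not depend on `p`. This is settled by a
lower bound `s_n(A) ≥ c (n + 1)⁻⁴`, valid for every nonzero weight
(`IsFormOperator.exists_le_singularNumber`): membership in any of the classes then forces `p ≥ 1/4`,
so that the factor is at most `16`. For zero weight `A' = 0`. -/

lemma singularNumber_set_bddBelow (A : E →L[ℂ] E) (n : ℕ) :
    BddBelow {r : ℝ | ∃ F : E →L[ℂ] E, (F : E →ₗ[ℂ] E).rank ≤ (n : Cardinal) ∧ r = ‖A - F‖} :=
  ⟨0, by rintro _ ⟨F, -, rfl⟩; exact norm_nonneg _⟩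

lemma singularNumber_set_nonempty (A : E →L[ℂ] E) (n : ℕ) :
    {r : ℝ | ∃ F : E →L[ℂ] E, (F : E →ₗ[ℂ] E).rank ≤ (n : Cardinal) ∧ r = ‖A - F‖}.Nonempty :=
  ⟨_, 0, by simp, rfl⟩

lemma singularNumber_nonneg (A : E →L[ℂ] E) (n : ℕ) : 0 ≤ singularNumber A n :=
  Real.sInf_nonneg (by rintro _ ⟨F, -, rfl⟩; exact norm_nonneg _)

lemma singularNumber_le {A F : E →L[ℂ] E} {n : ℕ}
    (hF : (F : E →ₗ[ℂ] E).rank ≤ (n : Cardinal)) : singularNumber A n ≤ ‖A - F‖ :=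
  csInf_le (singularNumber_set_bddBelow A n) ⟨F, hF, rfl⟩

lemma le_singularNumber {A : E →L[ℂ] E} {n : ℕ} {c : ℝ}
    (h : ∀ F : E →L[ℂ] E, (F : E →ₗ[ℂ] E).rank ≤ (n : Cardinal) → c ≤ ‖A - F‖) :
    c ≤ singularNumber A n :=
  le_csInf (singularNumber_set_nonempty A n) (by rintro _ ⟨F, hF, rfl⟩; exact h F hF)

lemma singularNumber_antitone (A : E →L[ℂ] E) : Antitone (singularNumber A) := by
  intro m n h
  exact le_singularNumber fun F hF => singularNumber_le (hF.trans (by exact_mod_cast h))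

lemma singularNumber_le_norm (A : E →L[ℂ] E) (n : ℕ) : singularNumber A n ≤ ‖A‖ := by
  simpa using singularNumber_le (A := A) (F := 0) (n := n) (by simp)

lemma norm_le_singularNumber_zero (A : E →L[ℂ] E) : ‖A‖ ≤ singularNumber A 0 := by
  refine le_singularNumber fun F hF => ?_
  have h0 : (F : E →ₗ[ℂ] E) = 0 := by
    have h1 : (F : E →ₗ[ℂ] E).rank = 0 := by simpa using hF
    rw [← LinearMap.range_eq_bot]
    exact Submodule.rank_eq_zero.mp h1
  have h1 : F = 0 := by
    ext x
    exact congrArg (fun L : E →ₗ[ℂ] E => L x) h0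
  simp [h1]

/-- On the kernel of `F` the form of `A` is that of `A - F`. Both the lower and the upper estimates
of singular numbers reduce to this. -/
lemma norm_inner_sub_le (A F : E →L[ℂ] E) {u : E} (hu : F u = 0) :
    ‖inner ℂ (A u) u‖ ≤ ‖A - F‖ * ‖u‖ ^ 2 := by
  have h1 : A u = (A - F) u := by simp [hu]
  rw [h1, pow_two, ← mul_assoc]
  exact (norm_inner_le_norm _ _).trans
    (mul_le_mul_of_nonneg_right ((A - F).le_opNorm u) (norm_nonneg _))

/-- A lower bound for singular numbers in terms of test spaces. -/
lemma le_singularNumber_of_testSpace {A : E →L[ℂ] E} {n : ℕ} {c : ℝ}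
    {L : (Fin (n + 1) → ℂ) →ₗ[ℂ] E} {q : (Fin (n + 1) → ℂ) → ℝ} {a b : ℝ} (hb : 0 < b)
    (hq : ∀ x, x ≠ 0 → 0 < q x) (ha : ∀ x, a * q x ≤ ‖inner ℂ (A (L x)) (L x)‖)
    (hn : ∀ x, ‖L x‖ ^ 2 ≤ b * q x) (hc : c * b ≤ a) : c ≤ singularNumber A n := by
  refine le_singularNumber fun F hF => ?_
  -- Dimension count: `F ∘ L` has rank at most `n` on a space of dimension `n + 1`, so some nonzero
  -- `x` is annihilated.
  obtain ⟨x, hx, hx0⟩ : ∃ x, ((F : E →ₗ[ℂ] E).comp L) x = 0 ∧ x ≠ 0 := by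
    by_contra! hcon
    have hinj : Function.Injective ((F : E →ₗ[ℂ] E).comp L) :=
      (injective_iff_map_eq_zero _).mpr fun x hx => hcon x hx
    have h1 := LinearMap.finrank_range_of_inj hinj
    have h2 : ((F : E →ₗ[ℂ] E).comp L).rank ≤ (n : Cardinal) :=
      (LinearMap.rank_comp_le_left _ _).trans hF
    rw [LinearMap.rank, ← Module.finrank_eq_rank, h1, Module.finrank_fin_fun] at h2
    have h3 : n + 1 ≤ n := by exact_mod_cast h2
    omega
  have h1 := norm_inner_sub_le A F (u := L x) hx
  have h2 := ha x
  have h3 := mul_le_mul_of_nonneg_left (hn x) (norm_nonneg (A - F))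
  have h4 : a * q x ≤ ‖A - F‖ * b * q x := by nlinarith
  have h5 := le_of_mul_le_mul_right h4 (hq x hx0)
  exact le_of_mul_le_mul_right (hc.trans h5) hb

end Seminormed

section Hilbert

lemma isCompactOperator_of_finite_range {H : Type*} [NormedAddCommGroup H] [InnerProductSpace ℂ H]
    (F : H →L[ℂ] H)
    (hF : Module.Finite ℂ (LinearMap.range (F : H →ₗ[ℂ] H))) : IsCompactOperator F := by
  have : ProperSpace (LinearMap.range (F : H →ₗ[ℂ] H)) := FiniteDimensional.proper ℂ _
  have h1 : IsCompactOperator (F.codRestrict (LinearMap.range (F : H →ₗ[ℂ] H)) fun x => ⟨x, rfl⟩) :=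
    isCompactOperator_of_locallyCompactSpace_dom _
  exact h1.clm_comp (LinearMap.range (F : H →ₗ[ℂ] H)).subtypeL

variable {H K : Type*} [NormedAddCommGroup H] [InnerProductSpace ℂ H] [CompleteSpace H]
  [NormedAddCommGroup K] [InnerProductSpace ℂ K] [CompleteSpace K]

open ContinuousLinearMap in
-- The easy half of the min-max principle. The approximant is `J* P J` with `P` the projection onto
-- the image under `J` of the orthogonal complement of `ker Φ`. Projecting in the target space keeps
-- the rank at most `m`, and the error is exactly `B* B` with `B = (1 - P) J`. Continuity of `Φ` is
-- not needed, as the estimate passes to the closure of its kernel.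
lemma singularNumber_adjoint_comp_self_le (J : H →L[ℂ] K) {X : Type*} [AddCommGroup X]
    [Module ℂ X] (Φ : H →ₗ[ℂ] X) (m : ℕ) (hΦ : Module.Finite ℂ Φ.range)
    (hr : Module.finrank ℂ Φ.range ≤ m) {σ : ℝ} (hσ : 0 ≤ σ)
    (h : ∀ u, Φ u = 0 → ‖J u‖ ^ 2 ≤ σ * ‖u‖ ^ 2) :
    singularNumber (adjoint J ∘L J) m ≤ σ := by
  set M := (LinearMap.ker Φ).topologicalClosure with hM
  have hMc : CompleteSpace M := (Submodule.isClosed_topologicalClosure _).completeSpace_coe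
  have hMb : ∀ u ∈ M, ‖J u‖ ^ 2 ≤ σ * ‖u‖ ^ 2 := by
    intro u hu
    have hcl : IsClosed {u : H | ‖J u‖ ^ 2 ≤ σ * ‖u‖ ^ 2} :=
      isClosed_le (by fun_prop) (by fun_prop)
    exact closure_minimal (fun v hv => h v (by simpa using hv)) hcl hu
  set f : Mᗮ →ₗ[ℂ] Φ.range := Φ.rangeRestrict.comp Mᗮ.subtype with hf
  have hfinj : Function.Injective f := by
    refine (injective_iff_map_eq_zero _).mpr fun x hx => ?_
    have h1 : Φ x = 0 := by simpa [f] using congrArg Subtype.val hx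
    have h2 : (x : H) ∈ M := Submodule.le_topologicalClosure _ (by simpa using h1)
    have h3 : inner ℂ (x : H) (x : H) = 0 := x.2 _ h2
    exact Subtype.ext (inner_self_eq_zero.mp h3)
  have hN : Module.Finite ℂ Mᗮ := Module.Finite.of_injective f hfinj
  have hNr : Module.finrank ℂ Mᗮ ≤ m := (LinearMap.finrank_le_finrank_of_injective hfinj).trans hr
  set R : Submodule ℂ K := Mᗮ.map (J : H →ₗ[ℂ] K) with hR
  have hRf : Module.Finite ℂ R := inferInstance
  have hRr : Module.finrank ℂ R ≤ m := (Submodule.finrank_map_le _ _).trans hNr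
  set P := R.starProjection with hP
  set G : H →L[ℂ] H := adjoint J ∘L P ∘L J with hG
  have hGr : (G : H →ₗ[ℂ] H).rank ≤ (m : Cardinal) := by
    have h1 : LinearMap.range (G : H →ₗ[ℂ] H) ≤ R.map (adjoint J : K →ₗ[ℂ] H) := by
      rintro _ ⟨u, rfl⟩
      exact ⟨P (J u), by simp [P], rfl⟩
    have h2 : (G : H →ₗ[ℂ] H).rank ≤ Module.rank ℂ (R.map (adjoint J : K →ₗ[ℂ] H)) :=
      Submodule.rank_mono h1
    refine h2.trans ?_
    rw [← Module.finrank_eq_rank]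
    exact_mod_cast (Submodule.finrank_map_le _ _).trans hRr
  refine (singularNumber_le hGr).trans ?_
  set B : H →L[ℂ] K := J - P ∘L J with hB
  have hBn : ∀ u, ‖B u‖ ≤ √σ * ‖u‖ := by
    intro u
    -- Since `B` vanishes on `Mᗮ`, only the component in `M` contributes, and there `J` is bounded
    -- by `√σ`.
    have hu : u = M.starProjection u + Mᗮ.starProjection u :=
      (Submodule.starProjection_add_starProjection_orthogonal (K := M) u).symm
    have h1 : B (Mᗮ.starProjection u) = 0 := by
      have : J (Mᗮ.starProjection u) ∈ R := ⟨_, by simp, rfl⟩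
      simp only [hB, sub_apply, comp_apply]
      rw [hP, Submodule.starProjection_eq_self_iff.mpr this, sub_self]
    have h2 : B u = Rᗮ.starProjection (J (M.starProjection u)) := by
      conv_lhs => rw [hu, map_add, h1, add_zero]
      have := Submodule.starProjection_add_starProjection_orthogonal (K := R) (J (M.starProjection u))
      simp only [hB, sub_apply, comp_apply, hP]
      rw [sub_eq_iff_eq_add', this]
    have h3 : ‖J (M.starProjection u)‖ ≤ √σ * ‖M.starProjection u‖ := by
      refine le_of_sq_le_sq ?_ (by positivity)
      rw [mul_pow, Real.sq_sqrt hσ]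
      exact hMb _ (by simp)
    rw [h2]
    refine ((Submodule.norm_starProjection_apply_le _ _).trans h3).trans ?_
    exact mul_le_mul_of_nonneg_left (Submodule.norm_starProjection_apply_le _ _) (Real.sqrt_nonneg _)
  have hBB : adjoint J ∘L J - G = adjoint B ∘L B := by
    ext u
    refine ext_inner_right ℂ fun v => ?_
    have hsa : ∀ x y : K, inner ℂ (P x) y = inner ℂ x (P y) := fun x y =>
      Submodule.inner_starProjection_left_eq_right R x y
    have hid : ∀ x, P (P x) = P x := fun x =>
      Submodule.starProjection_eq_self_iff.mpr (by simp [P])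
    simp only [sub_apply, comp_apply, hG, adjoint_inner_left, inner_sub_left, hB, inner_sub_right,
      hsa, hid]
    ring
  rw [hBB, norm_adjoint_comp_self]
  have h4 : ‖B‖ ≤ √σ := opNorm_le_bound _ (Real.sqrt_nonneg _) hBn
  calc ‖B‖ * ‖B‖ ≤ √σ * √σ := mul_self_le_mul_self (norm_nonneg _) h4
    _ = σ := Real.mul_self_sqrt hσ

lemma isCompactOperator_of_tendsto_singularNumber (A : H →L[ℂ] H)
    (h : Tendsto (singularNumber A) atTop (𝓝 0)) : IsCompactOperator A := by
  -- The infimum need not be known to be attained; the slack `1 / (n + 1)` tends to zero, so `A` is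
  -- a norm limit of finite-rank operators.
  have h1 : ∀ n : ℕ, ∃ F : H →L[ℂ] H, (F : H →ₗ[ℂ] H).rank ≤ (n : Cardinal) ∧
      ‖A - F‖ < singularNumber A n + 1 / ((n : ℝ) + 1) := by
    intro n
    obtain ⟨_, ⟨F, hF, rfl⟩, hlt⟩ := exists_lt_of_csInf_lt (singularNumber_set_nonempty A n)
      (show sInf _ < singularNumber A n + 1 / ((n : ℝ) + 1) from
        lt_add_of_pos_right _ (by positivity))
    exact ⟨F, hF, hlt⟩
  choose F hF hlt using h1
  have hT : Tendsto F atTop (𝓝 A) := by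
    rw [tendsto_iff_norm_sub_tendsto_zero]
    refine squeeze_zero (fun n => norm_nonneg _) (fun n => ?_)
      (by simpa using h.add tendsto_one_div_add_atTop_nhds_zero_nat)
    rw [norm_sub_rev]
    simpa using (hlt n).le
  refine isCompactOperator_of_tendsto hT (Eventually.of_forall fun n => ?_)
  refine isCompactOperator_of_finite_range _ ?_
  rw [← Module.rank_lt_aleph0_iff]
  exact (hF n).trans_lt (Cardinal.natCast_lt_aleph0)

end Hilbert

section Separated

variable {E K : Type*} [sE : SeminormedAddCommGroup E] [InnerProductSpace ℂ E] [CompleteSpace E]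
  [NormedAddCommGroup K] [InnerProductSpace ℂ K] [CompleteSpace K]

/-- The operator `J* J` for an operator `J` from a seminormed space which happens to be a Hilbert
space. -/
lemma exists_adjoint_comp_self (hsep : ∀ u : E, ‖u‖ = 0 → u = 0) (J : E →L[ℂ] K) :
    ∃ B : E →L[ℂ] E, (∀ u, inner ℂ (B u) u = ((‖J u‖ ^ 2 : ℝ) : ℂ)) ∧
      ‖B‖ ≤ ‖J‖ ^ 2 ∧
      (∀ (X : Type) [AddCommGroup X] [Module ℂ X] (Φ : E →ₗ[ℂ] X) (m : ℕ),
        Module.Finite ℂ Φ.range → Module.finrank ℂ Φ.range ≤ m → ∀ σ : ℝ, 0 ≤ σ →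
        (∀ u, Φ u = 0 → ‖J u‖ ^ 2 ≤ σ * ‖u‖ ^ 2) → singularNumber B m ≤ σ) ∧
      (Tendsto (singularNumber B) atTop (𝓝 0) → IsCompactOperator B) := by
  -- The function spaces carry only a seminorm instance, whereas adjoints need a norm. The upgrade
  -- stays local: whatever is needed about `J* J` is exported in seminorm terms.
  let _ : NormedAddCommGroup E := NormedAddCommGroup.ofSeparation hsep
  refine ⟨ContinuousLinearMap.adjoint J ∘L J, fun u => ?_, ?_, ?_, ?_⟩
  · rw [ContinuousLinearMap.comp_apply, ContinuousLinearMap.adjoint_inner_left,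
      inner_self_eq_norm_sq_to_K]
    simp
  · rw [ContinuousLinearMap.norm_adjoint_comp_self, pow_two]
  · intro X _ _ Φ m h1 h2 σ hσ h
    exact singularNumber_adjoint_comp_self_le J Φ m h1 h2 hσ h
  · exact isCompactOperator_of_tendsto_singularNumber _

end Separated

end SingularNumbers

/-! ### Operator classes under a shift of singular numbers -/

section ClassEstimates

lemma rpow_inv_le_sixteen {p : ℝ} (hp : 1 / 4 ≤ p) : (2 : ℝ) ^ (1 / p) ≤ 16 := by
  have h1 : 1 / p ≤ 4 := by
    rw [div_le_iff₀ (by linarith)]; linarith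
  calc (2 : ℝ) ^ (1 / p) ≤ (2 : ℝ) ^ (4 : ℝ) := Real.rpow_le_rpow_of_exponent_le (by norm_num) h1
    _ = 16 := by norm_num

lemma summable_rpow_succ {a b : ℕ → ℝ} {p : ℝ} (hp : 0 < p) (hb : ∀ n, 0 ≤ b n)
    (hab : ∀ n, b (n + 1) ≤ a n) (hs : Summable fun n => a n ^ p) : Summable fun n => b n ^ p := by
  rw [← summable_nat_add_iff 1]
  exact Summable.of_nonneg_of_le (fun n => Real.rpow_nonneg (hb _) _)
    (fun n => Real.rpow_le_rpow (hb _) (hab n) hp.le) hs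

lemma le_tsum_rpow {a : ℕ → ℝ} {p : ℝ} (hp : 0 < p) (ha : ∀ n, 0 ≤ a n)
    (hs : Summable fun n => a n ^ p) : a 0 ≤ (∑' n, a n ^ p) ^ (1 / p) := by
  have h1 : a 0 ^ p ≤ ∑' n, a n ^ p := hs.le_tsum 0 fun n _ => Real.rpow_nonneg (ha n) _
  calc a 0 = (a 0 ^ p) ^ (1 / p) := by
        rw [← Real.rpow_mul (ha 0), mul_one_div_cancel hp.ne', Real.rpow_one]
    _ ≤ _ := Real.rpow_le_rpow (Real.rpow_nonneg (ha 0) _) h1 (by positivity)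

lemma tsum_rpow_succ_le {a b : ℕ → ℝ} {p C X : ℝ} (hp : 1 / 4 ≤ p) (ha : ∀ n, 0 ≤ a n)
    (hb : ∀ n, 0 ≤ b n) (hab : ∀ n, b (n + 1) ≤ a n) (hC : 1 ≤ C) (hX : 0 ≤ X)
    (h0 : b 0 ≤ C * (a 0 + X)) (hs : Summable fun n => a n ^ p) :
    (∑' n, b n ^ p) ^ (1 / p) ≤ 16 * C * ((∑' n, a n ^ p) ^ (1 / p) + X) := by
  have hp0 : 0 < p := by linarith
  set S := ∑' n, a n ^ p with hS
  have hS0 : 0 ≤ S := tsum_nonneg fun n => Real.rpow_nonneg (ha n) _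
  set N := S ^ (1 / p) with hN
  have hN0 : 0 ≤ N := Real.rpow_nonneg hS0 _
  have hSN : S = N ^ p := by
    rw [hN, ← Real.rpow_mul hS0, one_div_mul_cancel hp0.ne', Real.rpow_one]
  set D := C * (N + X) with hD
  have hND : N ≤ D := by nlinarith
  have hb0D : b 0 ≤ D := h0.trans
    (mul_le_mul_of_nonneg_left (by linarith [le_tsum_rpow hp0 ha hs]) (by linarith))
  have hbs := summable_rpow_succ hp0 hb hab hs
  -- The head `b 0 ^ p` and the shifted tail are each at most `D ^ p`; the factor `2` becomes `2 ^
  -- (1 / p)` after taking the root.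
  have h1 : ∑' n, b n ^ p ≤ 2 * D ^ p := by
    rw [hbs.tsum_eq_zero_add]
    have h2 : ∑' n, b (n + 1) ^ p ≤ S :=
      ((summable_nat_add_iff 1).mpr hbs).tsum_le_tsum
        (fun n => Real.rpow_le_rpow (hb _) (hab n) hp0.le) hs
    have h3 : b 0 ^ p ≤ D ^ p := Real.rpow_le_rpow (hb 0) hb0D hp0.le
    have h4 : S ≤ D ^ p := hSN ▸ Real.rpow_le_rpow hN0 hND hp0.le
    linarith
  have hD0 : 0 ≤ D := hN0.trans hND
  calc (∑' n, b n ^ p) ^ (1 / p) ≤ (2 * D ^ p) ^ (1 / p) :=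
        Real.rpow_le_rpow (tsum_nonneg fun n => Real.rpow_nonneg (hb n) _) h1 (by positivity)
    _ = 2 ^ (1 / p) * D := by
        rw [Real.mul_rpow (by norm_num) (Real.rpow_nonneg hD0 _), ← Real.rpow_mul hD0,
          mul_one_div_cancel hp0.ne', Real.rpow_one]
    _ ≤ 16 * D := mul_le_mul_of_nonneg_right (rpow_inv_le_sixteen hp) hD0
    _ = 16 * C * (N + X) := by rw [hD]; ring

/-- The shift replaces the weight at `n` by that at `n + 1`, and `n + 2 ≤ 2 (n + 1)`. -/
lemma weak_succ_le {a b : ℕ → ℝ} {p : ℝ} (hp : 0 < p) (ha : ∀ n, 0 ≤ a n)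
    (hab : ∀ n, b (n + 1) ≤ a n) (n : ℕ) :
    (((n + 1 : ℕ) : ℝ) + 1) ^ (1 / p) * b (n + 1) ≤
      2 ^ (1 / p) * (((n : ℝ) + 1) ^ (1 / p) * a n) := by
  have h1 : (((n + 1 : ℕ) : ℝ) + 1) ^ (1 / p) ≤ 2 ^ (1 / p) * ((n : ℝ) + 1) ^ (1 / p) := by
    rw [← Real.mul_rpow (by norm_num) (by positivity)]
    refine Real.rpow_le_rpow (by positivity) ?_ (by positivity)
    push_cast; linarith [(Nat.cast_nonneg n : (0 : ℝ) ≤ n)]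
  calc _ ≤ (((n + 1 : ℕ) : ℝ) + 1) ^ (1 / p) * a n :=
        mul_le_mul_of_nonneg_left (hab n) (by positivity)
    _ ≤ (2 ^ (1 / p) * ((n : ℝ) + 1) ^ (1 / p)) * a n := mul_le_mul_of_nonneg_right h1 (ha n)
    _ = _ := by ring

lemma bddAbove_weak_succ {a b : ℕ → ℝ} {p : ℝ} (hp : 0 < p) (ha : ∀ n, 0 ≤ a n)
    (hab : ∀ n, b (n + 1) ≤ a n)
    (hs : BddAbove (Set.range fun n : ℕ => ((n : ℝ) + 1) ^ (1 / p) * a n)) :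
    BddAbove (Set.range fun n : ℕ => ((n : ℝ) + 1) ^ (1 / p) * b n) := by
  obtain ⟨M, hM⟩ := hs
  refine ⟨max (((0 : ℕ) + 1 : ℝ) ^ (1 / p) * b 0) (2 ^ (1 / p) * M), ?_⟩
  rintro _ ⟨n, rfl⟩
  rcases n with _ | n
  · simp
  · refine ((weak_succ_le hp ha hab n).trans ?_).trans (le_max_right _ _)
    exact mul_le_mul_of_nonneg_left (hM ⟨n, rfl⟩) (by positivity)

lemma iSup_weak_succ_le {a b : ℕ → ℝ} {p C X : ℝ} (hp : 1 / 4 ≤ p) (ha : ∀ n, 0 ≤ a n)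
    (hab : ∀ n, b (n + 1) ≤ a n) (hC : 1 ≤ C) (hX : 0 ≤ X) (h0 : b 0 ≤ C * (a 0 + X))
    (hs : BddAbove (Set.range fun n : ℕ => ((n : ℝ) + 1) ^ (1 / p) * a n)) :
    ⨆ n : ℕ, ((n : ℝ) + 1) ^ (1 / p) * b n ≤
      16 * C * ((⨆ n : ℕ, ((n : ℝ) + 1) ^ (1 / p) * a n) + X) := by
  have hp0 : 0 < p := by linarith
  set N := ⨆ n : ℕ, ((n : ℝ) + 1) ^ (1 / p) * a n with hN
  have hle : ∀ n : ℕ, ((n : ℝ) + 1) ^ (1 / p) * a n ≤ N := fun n => le_ciSup hs n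
  have haN : a 0 ≤ N := by simpa using hle 0
  have hN0 : 0 ≤ N := (ha 0).trans haN
  refine ciSup_le fun n => ?_
  rcases n with _ | n
  · have h1 : C * (a 0 + X) ≤ C * (N + X) :=
      mul_le_mul_of_nonneg_left (by linarith) (by linarith)
    have h2 : 0 ≤ C * (N + X) := mul_nonneg (by linarith) (by linarith)
    simp only [Nat.cast_zero, zero_add, Real.one_rpow, one_mul]
    nlinarith
  · refine (weak_succ_le hp0 ha hab n).trans ?_
    calc 2 ^ (1 / p) * (((n : ℝ) + 1) ^ (1 / p) * a n) ≤ 16 * N :=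
          mul_le_mul (rpow_inv_le_sixteen hp) (hle n)
            (mul_nonneg (by positivity) (ha n)) (by norm_num)
      _ ≤ 16 * (C * (N + X)) := by nlinarith
      _ = _ := by ring

lemma tendsto_weak_succ {a b : ℕ → ℝ} {p : ℝ} (hp : 0 < p) (ha : ∀ n, 0 ≤ a n)
    (hb : ∀ n, 0 ≤ b n) (hab : ∀ n, b (n + 1) ≤ a n)
    (hs : Tendsto (fun n : ℕ => ((n : ℝ) + 1) ^ (1 / p) * a n) atTop (𝓝 0)) :
    Tendsto (fun n : ℕ => ((n : ℝ) + 1) ^ (1 / p) * b n) atTop (𝓝 0) := by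
  rw [← tendsto_add_atTop_iff_nat 1]
  refine squeeze_zero (fun n => mul_nonneg (by positivity) (hb _)) (weak_succ_le hp ha hab) ?_
  simpa using hs.const_mul (2 ^ (1 / p))

lemma tendsto_zero_of_weak {a : ℕ → ℝ} {p : ℝ} (hp : 0 < p) (ha : ∀ n, 0 ≤ a n)
    (hs : BddAbove (Set.range fun n : ℕ => ((n : ℝ) + 1) ^ (1 / p) * a n)) :
    Tendsto a atTop (𝓝 0) := by
  obtain ⟨M, hM⟩ := hs
  have h1 : Tendsto (fun n : ℕ => M * ((n : ℝ) + 1) ^ (-(1 / p))) atTop (𝓝 0) := by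
    have h2 := (tendsto_rpow_neg_atTop (show 0 < 1 / p by positivity)).comp
      (tendsto_atTop_add_const_right atTop (1 : ℝ) tendsto_natCast_atTop_atTop)
    simpa using h2.const_mul M
  refine squeeze_zero ha (fun n => ?_) h1
  have h3 := hM ⟨n, rfl⟩
  have hn : (0 : ℝ) ≤ (n : ℝ) + 1 := by positivity
  rw [Real.rpow_neg hn, ← div_eq_mul_inv, le_div_iff₀ (by positivity), mul_comm]
  exact h3

/-- Chebyshev's inequality: by monotonicity, `(n + 1) a_n ^ p` is at most the sum of the first `n +
1` terms. -/
lemma bddAbove_weak_of_summable {a : ℕ → ℝ} {p : ℝ} (hp : 0 < p) (ha : ∀ n, 0 ≤ a n)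
    (hanti : Antitone a) (hs : Summable fun n => a n ^ p) :
    BddAbove (Set.range fun n : ℕ => ((n : ℝ) + 1) ^ (1 / p) * a n) := by
  refine ⟨(∑' n, a n ^ p) ^ (1 / p), ?_⟩
  rintro _ ⟨n, rfl⟩
  have h1 : ((n : ℝ) + 1) * a n ^ p ≤ ∑' n, a n ^ p := by
    have h2 := hs.sum_le_tsum (Finset.range (n + 1)) fun i _ => Real.rpow_nonneg (ha i) _
    refine le_trans ?_ h2
    have h3 := Finset.card_nsmul_le_sum (Finset.range (n + 1)) (fun i => a i ^ p) (a n ^ p)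
      fun i hi => Real.rpow_le_rpow (ha n)
        (hanti (Nat.lt_succ_iff.mp (Finset.mem_range.mp hi))) hp.le
    simpa using h3
  calc ((n : ℝ) + 1) ^ (1 / p) * a n = (((n : ℝ) + 1) * a n ^ p) ^ (1 / p) := by
        rw [Real.mul_rpow (by positivity) (Real.rpow_nonneg (ha n) _), ← Real.rpow_mul (ha n),
          mul_one_div_cancel hp.ne', Real.rpow_one]
    _ ≤ _ := Real.rpow_le_rpow (mul_nonneg (by positivity) (Real.rpow_nonneg (ha n) _)) h1
        (by positivity)

/-- Decay no faster than `n⁻⁴` is incompatible with `O(n^(-1/p))` when `1 / p > 4`. The exponent `4`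
is not essential: any fixed power would make the final constant independent of `p`. -/
lemma quarter_le_of_weak {a : ℕ → ℝ} {p c : ℝ} (hp : 0 < p) (hc : 0 < c)
    (hlow : ∀ n : ℕ, c ≤ ((n : ℝ) + 1) ^ 4 * a n)
    (hs : BddAbove (Set.range fun n : ℕ => ((n : ℝ) + 1) ^ (1 / p) * a n)) : 1 / 4 ≤ p := by
  by_contra! hlt
  obtain ⟨M, hM⟩ := hs
  have hq : 0 < 1 / p - 4 := by
    rw [sub_pos, lt_div_iff₀ hp]; linarith
  have h1 : Tendsto (fun n : ℕ => ((n : ℝ) + 1) ^ (1 / p - 4)) atTop atTop :=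
    (tendsto_rpow_atTop hq).comp
      (tendsto_atTop_add_const_right atTop (1 : ℝ) tendsto_natCast_atTop_atTop)
  obtain ⟨n, hn⟩ := (h1.eventually (eventually_gt_atTop (M / c))).exists
  have hn0 : (0 : ℝ) < (n : ℝ) + 1 := by positivity
  rw [div_lt_iff₀ hc] at hn
  have h2 : ((n : ℝ) + 1) ^ (1 / p) * a n =
      ((n : ℝ) + 1) ^ (1 / p - 4) * (((n : ℝ) + 1) ^ 4 * a n) := by
    rw [Real.rpow_sub hn0, show ((n : ℝ) + 1) ^ (4 : ℝ) = ((n : ℝ) + 1) ^ 4 by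
      simp]
    field_simp
  have h3 := hM ⟨n, rfl⟩
  simp only [h2] at h3
  have h4 := mul_le_mul_of_nonneg_left (hlow n) (Real.rpow_nonneg hn0.le (1 / p - 4))
  linarith

variable {E E' : Type*} [SeminormedAddCommGroup E] [InnerProductSpace ℂ E]
  [SeminormedAddCommGroup E'] [InnerProductSpace ℂ E']

lemma singularNumber_zero (n : ℕ) : singularNumber (0 : E →L[ℂ] E) n = 0 :=
  le_antisymm (by simpa using singularNumber_le_norm (0 : E →L[ℂ] E) n) (singularNumber_nonneg _ _)

/-- Passage of operator classes from `A` to `A'` if the singular numbers of `A'` are majorized by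
those of `A` after a shift by one. -/
lemma class_estimates {A : E →L[ℂ] E} {A' : E' →L[ℂ] E'} {C X : ℝ} (hC : 1 ≤ C) (hX : 0 ≤ X)
    (hshift : ∀ n, singularNumber A' (n + 1) ≤ singularNumber A n)
    (h0 : singularNumber A' 0 ≤ C * (singularNumber A 0 + X))
    (hcomp : Tendsto (singularNumber A') atTop (𝓝 0) → IsCompactOperator A')
    (hlow : A' = 0 ∨ ∃ c, 0 < c ∧ ∀ n : ℕ, c ≤ ((n : ℝ) + 1) ^ 4 * singularNumber A n)
    {p : ℝ} (hp : 0 < p) :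
    (MemSchatten p A → MemSchatten p A' ∧ schattenNorm p A' ≤ 16 * C * (schattenNorm p A + X)) ∧
    (MemWeakSchatten p A → MemWeakSchatten p A' ∧
      weakSchattenNorm p A' ≤ 16 * C * (weakSchattenNorm p A + X)) ∧
    (MemWeakSchattenZero p A → MemWeakSchattenZero p A' ∧
      weakSchattenNorm p A' ≤ 16 * C * (weakSchattenNorm p A + X)) := by
  have ha := singularNumber_nonneg A
  have hb := singularNumber_nonneg A'
  have hcb : BddAbove (Set.range fun n : ℕ => ((n : ℝ) + 1) ^ (1 / p) * singularNumber A n) →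
      IsCompactOperator A' := fun h =>
    hcomp (tendsto_zero_of_weak hp hb (bddAbove_weak_succ hp ha hshift h))
  have hweak : BddAbove (Set.range fun n : ℕ => ((n : ℝ) + 1) ^ (1 / p) * singularNumber A n) →
      weakSchattenNorm p A' ≤ 16 * C * (weakSchattenNorm p A + X) := by
    intro h
    rcases hlow with rfl | ⟨c, hc, hlow⟩
    · have h1 : weakSchattenNorm p (0 : E' →L[ℂ] E') = 0 := by
        simp [weakSchattenNorm, singularNumber_zero]
      have h2 : 0 ≤ weakSchattenNorm p A :=
        Real.iSup_nonneg fun n => mul_nonneg (by positivity) (ha n)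
      rw [h1]
      exact mul_nonneg (by linarith) (by linarith)
    · exact iSup_weak_succ_le (quarter_le_of_weak hp hc hlow h) ha hshift hC hX h0 h
  refine ⟨fun h => ?_, fun h => ?_, fun h => ?_⟩
  · have hbd := bddAbove_weak_of_summable hp ha (singularNumber_antitone A) h.2
    refine ⟨⟨hcb hbd, summable_rpow_succ hp hb hshift h.2⟩, ?_⟩
    rcases hlow with rfl | ⟨c, hc, hlow⟩
    · have h1 : schattenNorm p (0 : E' →L[ℂ] E') = 0 := by
        simp [schattenNorm, singularNumber_zero, Real.zero_rpow hp.ne',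
          Real.zero_rpow (inv_ne_zero hp.ne')]
      have h2 : 0 ≤ schattenNorm p A :=
        Real.rpow_nonneg (tsum_nonneg fun n => Real.rpow_nonneg (ha n) _) _
      rw [h1]
      exact mul_nonneg (by linarith) (by linarith)
    · exact tsum_rpow_succ_le (quarter_le_of_weak hp hc hlow hbd) ha hb hshift hC hX h0 h.2
  · exact ⟨⟨hcb h.2, bddAbove_weak_succ hp ha hshift h.2⟩, hweak h.2⟩
  · have hbd := h.2.bddAbove_range
    exact ⟨⟨hcb hbd, tendsto_weak_succ hp ha hb hshift h.2⟩, hweak hbd⟩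

end ClassEstimates

/-! ### Combinatorics of edges and points -/

namespace RegularTree

variable (T : RegularTree)

lemma t_nonneg (n : ℕ) : 0 ≤ T.t n := T.t_zero ▸ T.t_strictMono.monotone (Nat.zero_le n)

lemma t_lt_succ (n : ℕ) : T.t n < T.t (n + 1) := T.t_strictMono (Nat.lt_succ_self n)

lemma t_one_pos : 0 < T.t 1 := T.t_zero ▸ T.t_lt_succ 0

lemma exists_mem_Ioc {s : ℝ} (hs : 0 < s) : ∃ n, s ∈ Set.Ioc (T.t n) (T.t (n + 1)) := by
  classical
  have h : ∃ n, s ≤ T.t (n + 1) := by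
    obtain ⟨n, hn⟩ := T.t_unbounded s
    exact ⟨n, hn.le.trans (T.t_lt_succ n).le⟩
  refine ⟨Nat.find h, ?_, Nat.find_spec h⟩
  rcases hn : Nat.find h with _ | m
  · rwa [T.t_zero]
  · exact not_le.mp (Nat.find_min h (m := m) (by omega))

lemma gen_eq {n : ℕ} {s : ℝ} (hs : s ∈ Set.Ioc (T.t n) (T.t (n + 1))) : T.gen s = n := by
  refine le_antisymm (Nat.sInf_le hs.2) ?_
  refine le_csInf ⟨n, hs.2⟩ fun m hm => ?_
  have h1 : T.t n < T.t (m + 1) := hs.1.trans_le hm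
  exact Nat.lt_succ_iff.mp (T.t_strictMono.lt_iff_lt.mp h1)

/-- The number of edges of generation `n`, equal to `g₀` on `(t n, t (n + 1)]`. -/
def edgeCount (n : ℕ) : ℝ := ∏ i ∈ Finset.range (n + 1), (T.b i : ℝ)

lemma b_pos (n : ℕ) : 0 < T.b n := by
  rcases eq_or_ne n 0 with rfl | h
  · simp [T.b_zero]
  · exact zero_lt_one.trans (T.one_lt_b n h)

lemma edgeCount_pos (n : ℕ) : 0 < T.edgeCount n :=
  Finset.prod_pos fun i _ => by exact_mod_cast T.b_pos i

lemma one_le_edgeCount (n : ℕ) : 1 ≤ T.edgeCount n :=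
  Finset.prod_induction _ (1 ≤ ·) (fun _ _ => one_le_mul_of_one_le_of_one_le) le_rfl
    fun i _ => by exact_mod_cast T.b_pos i

lemma edgeCount_succ (n : ℕ) : T.edgeCount (n + 1) = T.edgeCount n * T.b (n + 1) :=
  Finset.prod_range_succ _ _

lemma g₀_eq {n : ℕ} {s : ℝ} (hs : s ∈ Set.Ioc (T.t n) (T.t (n + 1))) :
    T.g₀ s = T.edgeCount n := by
  rw [g₀, T.gen_eq hs, edgeCount]

lemma g₀_pos (s : ℝ) : 0 < T.g₀ s := T.edgeCount_pos _

lemma card_branches (n : ℕ) :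
    (Fintype.card (∀ i : Fin (n + 1), Fin (T.b i)) : ℝ) = T.edgeCount n := by
  rw [Fintype.card_pi, edgeCount, Finset.prod_range]
  simp

instance : Countable T.Edge :=
  inferInstanceAs (Countable (Σ n : ℕ, ∀ i : Fin (n + 1), Fin (T.b i)))

variable {T}

lemma Point.ext_of_branch {x y : T.Point} (h : x.height = y.height)
    (hb : ∀ i hx hy, x.branch i hx = y.branch i hy) : x = y := by
  obtain ⟨s, hs, c⟩ := x
  obtain ⟨r, hr, d⟩ := y
  obtain rfl : s = r := h
  have : c = d := funext fun i => funext fun hi => hb i hi hi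
  rw [this]

lemma height_pt {e : T.Edge} {s : ℝ} (h0 : 0 ≤ s) (hs : s ≤ T.t (e.1 + 1)) :
    (T.pt e s).height = s := by
  simp [pt, hs, h0]

lemma height_pt_of_mem {e : T.Edge} {s : ℝ} (hs : s ∈ T.edgeIcc e) : (T.pt e s).height = s :=
  height_pt ((T.t_nonneg _).trans hs.1) hs.2

lemma pt_max_min (e : T.Edge) (s : ℝ) : T.pt e (max 0 (min s (T.t (e.1 + 1)))) = T.pt e s := by
  refine Point.ext_of_branch ?_ fun i hx hy => rfl
  have := T.t_nonneg (e.1 + 1)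
  simp [pt, this]

lemma pt_zero_left (c : ∀ i : Fin (0 + 1), Fin (T.b i)) : T.pt ⟨0, c⟩ 0 = T.root := by
  refine Point.ext_of_branch ?_ fun i hx hy => ?_
  · simp [pt, root, T.t_nonneg]
  · exact absurd hy (not_lt.mpr (T.t_nonneg i))

/-- The edge of generation `n` below an edge of generation `n + 1`. -/
def parent {n : ℕ} (c : ∀ i : Fin (n + 1 + 1), Fin (T.b i)) : ∀ i : Fin (n + 1), Fin (T.b i) :=
  fun i => c i.castSucc

/-- This is how edges are glued: the path from the root to an edge runs along its parent. It drives
every induction over generations. -/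
lemma pt_parent {n : ℕ} (c : ∀ i : Fin (n + 1 + 1), Fin (T.b i)) {s : ℝ} (hs : s ≤ T.t (n + 1)) :
    T.pt ⟨n + 1, c⟩ s = T.pt ⟨n, parent c⟩ s := by
  refine Point.ext_of_branch ?_ fun i hx hy => rfl
  simp only [pt]
  rw [min_eq_left hs, min_eq_left (hs.trans (T.t_lt_succ _).le)]

lemma exists_pt_eq (x : T.Point) :
    ∃ (n : ℕ) (c : ∀ i : Fin (n + 1), Fin (T.b i)) (s : ℝ),
      s ∈ Set.Icc (T.t n) (T.t (n + 1)) ∧ T.pt ⟨n, c⟩ s = x ∧ x.height = s := by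
  rcases eq_or_lt_of_le x.height_nonneg with h | h
  · refine ⟨0, fun i => ⟨0, T.b_pos i⟩, 0, ⟨T.t_zero.le, T.t_nonneg 1⟩, ?_, h.symm⟩
    rw [pt_zero_left]
    refine Point.ext_of_branch (by simpa [root] using h) fun i hx hy => ?_
    exact absurd (hy.trans_eq h.symm) (not_lt.mpr (T.t_nonneg i))
  · obtain ⟨n, hn⟩ := T.exists_mem_Ioc h
    refine ⟨n, fun i => x.branch i ((T.t_strictMono.monotone (Nat.lt_succ_iff.mp i.2)).trans_lt hn.1),
      x.height, ⟨hn.1.le, hn.2⟩, ?_, rfl⟩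
    exact Point.ext_of_branch (height_pt x.height_nonneg hn.2) fun i hx hy => rfl

/-! ### Measurability and integration on the tree -/

lemma measurable_iff {β : Type*} [MeasurableSpace β] {f : T.Point → β}
    (h : ∀ e, Measurable fun s => f (T.pt e s)) : Measurable f := by
  intro A hA
  refine MeasurableSpace.measurableSet_iInf.mpr fun e => ?_
  have := h e hA
  rw [BorelSpace.measurable_eq (α := ℝ)] at this
  exact this

lemma measurable_height : Measurable (Point.height : T.Point → ℝ) :=
  measurable_iff fun e => by simp only [pt]; fun_prop

lemma aemeasurable_map_pt {F : T.Point → ENNReal} (hF : AEMeasurable F T.measure) (e : T.Edge) :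
    AEMeasurable F ((volume.restrict (T.edgeIcc e)).map (T.pt e)) :=
  hF.mono_measure (T.map_pt_le_measure e)

lemma lintegral_measure {F : T.Point → ENNReal} (hF : AEMeasurable F T.measure) :
    ∫⁻ x, F x ∂T.measure = ∑' n : ℕ, ∑ c : (∀ i : Fin (n + 1), Fin (T.b i)),
      ∫⁻ s in Set.Icc (T.t n) (T.t (n + 1)), F (T.pt ⟨n, c⟩ s) := by
  rw [measure, lintegral_sum_measure]
  refine (ENNReal.tsum_sigma' _).trans ?_
  refine tsum_congr fun n => ?_
  rw [tsum_fintype]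
  refine Finset.sum_congr rfl fun c _ => ?_
  exact lintegral_map' (aemeasurable_map_pt hF ⟨n, c⟩) (T.measurable_pt _).aemeasurable

lemma iUnion_Ioc_t : ⋃ n, Set.Ioc (T.t n) (T.t (n + 1)) = Set.Ioi 0 := by
  ext s
  simp only [Set.mem_iUnion, Set.mem_Ioi]
  exact ⟨fun ⟨n, hn⟩ => (T.t_nonneg n).trans_lt hn.1, T.exists_mem_Ioc⟩

lemma lintegral_Ioi_zero (f : ℝ → ENNReal) :
    ∫⁻ s in Set.Ioi (0 : ℝ), f s = ∑' n, ∫⁻ s in Set.Ioc (T.t n) (T.t (n + 1)), f s := by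
  have hd : Pairwise (Function.onFun Disjoint fun n => Set.Ioc (T.t n) (T.t (n + 1))) :=
    T.t_strictMono.monotone.pairwise_disjoint_on_Ioc_succ
  rw [← iUnion_Ioc_t (T := T), lintegral_iUnion (fun _ => measurableSet_Ioc) hd]

/-- Integration of radial functions. -/
lemma lintegral_radial {f : ℝ → ENNReal} (hf : Measurable f) :
    ∫⁻ x : T.Point, f x.height ∂T.measure =
      ∫⁻ s in Set.Ioi (0 : ℝ), ENNReal.ofReal (T.g₀ s) * f s := by
  rw [lintegral_measure (F := fun x => f x.height) (hf.comp measurable_height).aemeasurable, lintegral_Ioi_zero (T := T)]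
  refine tsum_congr fun n => ?_
  have h1 : ∀ c : (∀ i : Fin (n + 1), Fin (T.b i)),
      ∫⁻ s in Set.Icc (T.t n) (T.t (n + 1)), f (T.pt ⟨n, c⟩ s).height =
        ∫⁻ s in Set.Ioc (T.t n) (T.t (n + 1)), f s := by
    intro c
    rw [setLIntegral_congr_fun (g := f) measurableSet_Icc
      fun s hs => by simp only [height_pt_of_mem (e := ⟨n, c⟩) hs]]
    exact setLIntegral_congr Ioc_ae_eq_Icc.symm
  have h2 : ∫⁻ s in Set.Ioc (T.t n) (T.t (n + 1)), ENNReal.ofReal (T.g₀ s) * f s =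
      ∫⁻ s in Set.Ioc (T.t n) (T.t (n + 1)), ENNReal.ofReal (T.edgeCount n) * f s :=
    setLIntegral_congr_fun measurableSet_Ioc fun s hs => by simp only [T.g₀_eq hs]
  rw [Finset.sum_congr rfl fun c _ => h1 c, Finset.sum_const, Finset.card_univ, nsmul_eq_mul, h2,
    lintegral_const_mul _ hf, ← card_branches, ENNReal.ofReal_natCast]

lemma measurable_g₀ : Measurable T.g₀ := by
  have h : ∀ s, T.g₀ s = T.edgeCount (T.gen s) := fun s => rfl
  have hg : Measurable T.gen := by
    refine measurable_of_Iic fun n => ?_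
    have : T.gen ⁻¹' Set.Iic n = Set.Iic (T.t (n + 1)) := by
      ext s
      simp only [Set.mem_preimage, Set.mem_Iic]
      constructor
      · intro h
        have hne : {n | s ≤ T.t (n + 1)}.Nonempty := by
          obtain ⟨n, hn⟩ := T.t_unbounded s
          exact ⟨n, hn.le.trans (T.t_lt_succ n).le⟩
        have h2 : s ≤ T.t (T.gen s + 1) := Nat.sInf_mem hne
        exact h2.trans (T.t_strictMono.monotone (by omega))
      · exact fun h => Nat.sInf_le h
    rw [this]
    exact measurableSet_Iic
  exact (measurable_from_nat (f := T.edgeCount)).comp hg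

lemma measure_height_le_lt_top (R : ℝ) : T.measure {x : T.Point | x.height ≤ R} < ⊤ := by
  obtain ⟨N, hN⟩ := T.t_unbounded R
  have hm : MeasurableSet {x : T.Point | x.height ≤ R} := measurable_height measurableSet_Iic
  have h1 : T.measure {x : T.Point | x.height ≤ R} =
      ∫⁻ x : T.Point, (Set.Iic R).indicator 1 x.height ∂T.measure := by
    rw [← lintegral_indicator_one hm]
    rfl
  rw [h1, lintegral_radial (measurable_one.indicator measurableSet_Iic)]
  have h2 : ∀ s ∈ Set.Ioi (0 : ℝ), ENNReal.ofReal (T.g₀ s) * (Set.Iic R).indicator 1 s ≤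
      (Set.Ioc 0 R).indicator (fun _ => ENNReal.ofReal (T.edgeCount N)) s := by
    intro s hs
    by_cases hsR : s ≤ R
    · rw [Set.indicator_of_mem (show s ∈ Set.Iic R from hsR),
        Set.indicator_of_mem (show s ∈ Set.Ioc 0 R from ⟨hs, hsR⟩)]
      simp only [Pi.one_apply, mul_one]
      refine ENNReal.ofReal_le_ofReal ?_
      -- Edge counts increase with the generation, so `g₀` is bounded by `edgeCount N` up to the
      -- height `R`.
      have hgen : T.gen s ≤ N := Nat.sInf_le (hsR.trans (hN.le.trans (T.t_lt_succ N).le))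
      exact monotone_nat_of_le_succ (f := T.edgeCount) (fun n => by
        rw [T.edgeCount_succ]
        exact le_mul_of_one_le_right (T.edgeCount_pos n).le (by exact_mod_cast T.b_pos _)) hgen
    · rw [Set.indicator_of_notMem (show s ∉ Set.Iic R from hsR)]
      simp
  calc _ ≤ ∫⁻ s in Set.Ioi (0 : ℝ),
        (Set.Ioc 0 R).indicator (fun _ => ENNReal.ofReal (T.edgeCount N)) s :=
        setLIntegral_mono' measurableSet_Ioi h2
    _ ≤ ∫⁻ s, (Set.Ioc 0 R).indicator (fun _ => ENNReal.ofReal (T.edgeCount N)) s :=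
        setLIntegral_le_lintegral _ _
    _ < ⊤ := by
        rw [lintegral_indicator measurableSet_Ioc, setLIntegral_const, Real.volume_Ioc]
        exact ENNReal.mul_lt_top ENNReal.ofReal_lt_top ENNReal.ofReal_lt_top

/-! ### Regularity of functions with square integrable derivative -/

lemma fn_pt_sub (u : T.DirichletSpace) (e : T.Edge) {r s : ℝ} (hr : r ∈ T.edgeIcc e)
    (hs : s ∈ T.edgeIcc e) :
    T.fn u (T.pt e s) - T.fn u (T.pt e r) = ∫ τ in r..s, T.der u (T.pt e τ) :=
  u.2 e r hr s hs

lemma norm_eq_norm_der (u : T.DirichletSpace) : ‖u‖ = ‖T.der u‖ := rfl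

lemma eLpNorm_pt_le (e : T.Edge) (w : Lp ℂ 2 T.measure) :
    eLpNorm (fun s => w (T.pt e s)) 2 (volume.restrict (T.edgeIcc e)) ≤ eLpNorm w 2 T.measure := by
  have h := eLpNorm_map_measure (p := 2)
    ((Lp.aestronglyMeasurable w).mono_measure (T.map_pt_le_measure e))
    (T.measurable_pt e).aemeasurable
  calc _ = eLpNorm w 2 ((volume.restrict (T.edgeIcc e)).map (T.pt e)) := h.symm
    _ ≤ _ := eLpNorm_mono_measure _ (T.map_pt_le_measure e)

/-- Cauchy–Schwarz on an edge of finite length. -/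
lemma exists_integral_pt_le (e : T.Edge) : ∃ C : ℝ, 0 ≤ C ∧ ∀ w : Lp ℂ 2 T.measure,
    ∀ r ∈ T.edgeIcc e, ∀ s ∈ T.edgeIcc e, ‖∫ τ in r..s, w (T.pt e τ)‖ ≤ C * ‖w‖ := by
  set μ := volume.restrict (T.edgeIcc e) with hμ
  have hfin : μ Set.univ ≠ ⊤ := by simp [μ, edgeIcc]
  set D : ENNReal := μ Set.univ ^ (1 / (1 : ENNReal).toReal - 1 / (2 : ENNReal).toReal) with hD
  have hDfin : D ≠ ⊤ := ENNReal.rpow_ne_top_of_nonneg (by norm_num) hfin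
  refine ⟨D.toReal, ENNReal.toReal_nonneg, fun w r hr s hs => ?_⟩
  have hint : Integrable (fun τ => w (T.pt e τ)) μ := T.integrableOn_pt e w
  have h1 : ‖∫ τ in r..s, w (T.pt e τ)‖ ≤ ∫ τ, ‖w (T.pt e τ)‖ ∂μ := by
    refine (intervalIntegral.norm_integral_le_integral_norm_uIoc).trans ?_
    exact setIntegral_mono_set hint.norm (Eventually.of_forall fun _ => norm_nonneg _)
      (Set.uIoc_subset_uIcc.trans (Set.ordConnected_Icc.uIcc_subset hr hs)).eventuallyLE
  refine h1.trans ?_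
  have h2 : ∫ τ, ‖w (T.pt e τ)‖ ∂μ = (eLpNorm (fun τ => w (T.pt e τ)) 1 μ).toReal := by
    rw [eLpNorm_one_eq_lintegral_enorm, integral_norm_eq_lintegral_enorm hint.1]
  rw [h2, Lp.norm_def, mul_comm, ← ENNReal.toReal_mul]
  refine ENNReal.toReal_mono (ENNReal.mul_ne_top (Lp.eLpNorm_ne_top w) hDfin) ?_
  refine (eLpNorm_le_eLpNorm_mul_rpow_measure_univ (q := 2) (by norm_num) hint.1).trans ?_
  exact mul_le_mul_left (eLpNorm_pt_le e w) _

/-- Point evaluations are controlled by the value at the root and the norm. -/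
lemma exists_norm_fn_le (x : T.Point) : ∃ C : ℝ, 0 ≤ C ∧ ∀ u : T.DirichletSpace,
    ‖T.fn u x‖ ≤ ‖T.fn u T.root‖ + C * ‖u‖ := by
  have key : ∀ (n : ℕ) (c : ∀ i : Fin (n + 1), Fin (T.b i)) (s : ℝ),
      s ∈ Set.Icc (T.t n) (T.t (n + 1)) → ∃ C : ℝ, 0 ≤ C ∧ ∀ u : T.DirichletSpace,
      ‖T.fn u (T.pt ⟨n, c⟩ s)‖ ≤ ‖T.fn u T.root‖ + C * ‖u‖ := by
    intro n
    induction n with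
    | zero =>
      intro c s hs
      obtain ⟨C, hC, h⟩ := exists_integral_pt_le (T := T) ⟨0, c⟩
      refine ⟨C, hC, fun u => ?_⟩
      have h0 : (0 : ℝ) ∈ T.edgeIcc ⟨0, c⟩ := ⟨T.t_zero.le, T.t_nonneg 1⟩
      have h1 := fn_pt_sub u ⟨0, c⟩ h0 hs
      rw [pt_zero_left, sub_eq_iff_eq_add'] at h1
      rw [h1]
      exact (norm_add_le _ _).trans (add_le_add_right (h _ _ h0 _ hs) _)
    | succ n ih =>
      intro c s hs
      obtain ⟨C, hC, h⟩ := exists_integral_pt_le (T := T) ⟨n + 1, c⟩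
      obtain ⟨C', hC', h'⟩ := ih (parent c) (T.t (n + 1)) ⟨(T.t_lt_succ n).le, le_rfl⟩
      refine ⟨C' + C, add_nonneg hC' hC, fun u => ?_⟩
      have h0 : T.t (n + 1) ∈ T.edgeIcc ⟨n + 1, c⟩ := ⟨le_rfl, (T.t_lt_succ (n + 1)).le⟩
      have h1 := fn_pt_sub u ⟨n + 1, c⟩ h0 hs
      rw [pt_parent c le_rfl, sub_eq_iff_eq_add'] at h1
      rw [h1, add_mul, ← add_assoc]
      exact (norm_add_le _ _).trans (add_le_add (h' u) (h _ _ h0 _ hs))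
  obtain ⟨n, c, s, hs, rfl, -⟩ := exists_pt_eq x
  exact key n c s hs

lemma continuousOn_fn_pt (u : T.DirichletSpace) (e : T.Edge) :
    ContinuousOn (fun s => T.fn u (T.pt e s)) (T.edgeIcc e) := by
  have h0 : T.t e.1 ∈ T.edgeIcc e := ⟨le_rfl, (T.t_lt_succ _).le⟩
  have h1 : ContinuousOn (fun s => T.fn u (T.pt e (T.t e.1)) +
      ∫ τ in (T.t e.1)..s, T.der u (T.pt e τ)) (T.edgeIcc e) :=
    continuousOn_const.add (by
      have hle := (T.t_lt_succ e.1).le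
      have := intervalIntegral.continuousOn_primitive_interval (a := T.t e.1) (b := T.t (e.1 + 1))
        (f := fun τ => T.der u (T.pt e τ)) (μ := volume)
        (by rw [Set.uIcc_of_le hle]; exact T.integrableOn_pt e (T.der u))
      rwa [Set.uIcc_of_le hle] at this)
  refine h1.congr fun s hs => ?_
  exact sub_eq_iff_eq_add'.mp (fn_pt_sub u e h0 hs)

/-- Continuity is required on all of `ℝ`, not just on the closed edge, because the measurability
criterion tests a function along the whole clamped path from the root. The pieces are glued at the
vertices. -/
lemma continuous_fn_pt (u : T.DirichletSpace) (e : T.Edge) :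
    Continuous fun s => T.fn u (T.pt e s) := by
  obtain ⟨n, c⟩ := e
  induction n with
  | zero =>
    have h1 : (fun s => T.fn u (T.pt ⟨0, c⟩ s)) =
        fun s => T.fn u (T.pt ⟨0, c⟩ (max 0 (min s (T.t (0 + 1))))) :=
      funext fun s => by rw [pt_max_min ⟨0, c⟩ s]
    rw [h1]
    refine (continuousOn_fn_pt u ⟨0, c⟩).comp_continuous (by fun_prop) fun s => ?_
    exact ⟨T.t_zero.le.trans (le_max_left _ _), max_le (T.t_nonneg _) (min_le_right _ _)⟩
  | succ n ih =>
    have h1 : (fun s => T.fn u (T.pt ⟨n + 1, c⟩ s)) = fun s => if s ≤ T.t (n + 1) then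
        T.fn u (T.pt ⟨n, parent c⟩ s) else
        T.fn u (T.pt ⟨n + 1, c⟩ (max (T.t (n + 1)) (min s (T.t (n + 1 + 1))))) := by
      funext s
      split_ifs with h
      · rw [pt_parent c h]
      · push Not at h
        have h2 : max (T.t (n + 1)) (min s (T.t (n + 1 + 1))) = min s (T.t (n + 1 + 1)) :=
          max_eq_right (le_min h.le (T.t_lt_succ _).le)
        have h3 : max 0 (min s (T.t (n + 1 + 1))) = min s (T.t (n + 1 + 1)) :=
          max_eq_right (le_min ((T.t_nonneg _).trans h.le) (T.t_nonneg _))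
        rw [h2, ← pt_max_min ⟨n + 1, c⟩ s]
        simp only [h3]
    rw [h1]
    refine Continuous.if_le (ih (parent c)) ?_ continuous_id continuous_const ?_
    · refine (continuousOn_fn_pt u ⟨n + 1, c⟩).comp_continuous (by fun_prop) fun s => ?_
      exact ⟨le_max_left _ _, max_le (T.t_lt_succ _).le (min_le_right _ _)⟩
    · rintro s rfl
      rw [min_eq_left (T.t_lt_succ _).le, max_self, pt_parent c le_rfl]

lemma measurable_fn (u : T.DirichletSpace) : Measurable (T.fn u) :=
  measurable_iff fun e => (continuous_fn_pt u e).measurable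

lemma memLp_of_bounded {f : T.Point → ℂ} (hf : AEStronglyMeasurable f T.measure) {K R : ℝ}
    (hK : ∀ x, ‖f x‖ ≤ K) (hR : ∀ x : T.Point, R < x.height → f x = 0) :
    MemLp f 2 T.measure := by
  have hm : MeasurableSet {x : T.Point | x.height ≤ R} := measurable_height measurableSet_Iic
  have h1 : {x : T.Point | x.height ≤ R}.indicator f = f := by
    rw [Set.indicator_eq_self]
    intro x hx
    by_contra h
    exact hx (hR x (not_le.mp h))
  have : IsFiniteMeasure (T.measure.restrict {x : T.Point | x.height ≤ R}) :=
    ⟨by simpa using measure_height_le_lt_top R⟩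
  rw [← h1, memLp_indicator_iff_restrict hm]
  exact MemLp.of_bound hf.restrict K (Eventually.of_forall hK)

lemma eLpNorm_le_of_bounded {f : T.Point → ℂ} {K R : ℝ}
    (hK : ∀ x, ‖f x‖ ≤ K) (hR : ∀ x : T.Point, R < x.height → f x = 0) :
    eLpNorm f 2 T.measure ≤
      T.measure {x : T.Point | x.height ≤ R} ^ (2 : ENNReal).toReal⁻¹ * ENNReal.ofReal K := by
  have hm : MeasurableSet {x : T.Point | x.height ≤ R} := measurable_height measurableSet_Iic
  have h1 : {x : T.Point | x.height ≤ R}.indicator f = f := by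
    rw [Set.indicator_eq_self]
    intro x hx
    by_contra h
    exact hx (hR x (not_le.mp h))
  rw [← h1, eLpNorm_indicator_eq_eLpNorm_restrict hm]
  refine (eLpNorm_le_of_ae_bound (Eventually.of_forall hK)).trans ?_
  simp

lemma ofReal_norm_sq_Lp (w : Lp ℂ 2 T.measure) :
    ENNReal.ofReal (‖w‖ ^ 2) = ∫⁻ x, ‖w x‖ₑ ^ 2 ∂T.measure := by
  have h := eLpNorm_nnreal_pow_eq_lintegral (f := w) (μ := T.measure) (p := 2) (by norm_num)
  rw [ENNReal.ofReal_pow (norm_nonneg _), Lp.norm_def, ENNReal.ofReal_toReal (Lp.eLpNorm_ne_top w)]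
  simpa using h

/-! ### Functions that are radial above an edge -/

/-- The points lying on or above an edge (without its lower endpoint). -/
def above (e : T.Edge) : Set T.Point :=
  {x | T.t e.1 < x.height ∧ ∀ (i : Fin (e.1 + 1)) (hi : T.t i < x.height), x.branch i hi = e.2 i}

/-- The edge `e'` coincides with `e` or lies above it. -/
def Below (e e' : T.Edge) : Prop :=
  ∃ h : e.1 ≤ e'.1, ∀ i : Fin (e.1 + 1), e'.2 (Fin.castLE (Nat.succ_le_succ h) i) = e.2 i

lemma pt_mem_above {e e' : T.Edge} {s : ℝ} :
    T.pt e' s ∈ above e ↔ Below e e' ∧ T.t e.1 < (T.pt e' s).height := by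
  constructor
  · rintro ⟨h1, h2⟩
    have h3 : (T.pt e' s).height ≤ T.t (e'.1 + 1) :=
      max_le (T.t_nonneg _) (min_le_right _ _)
    have h4 : e.1 ≤ e'.1 := Nat.lt_succ_iff.mp (T.t_strictMono.lt_iff_lt.mp (h1.trans_le h3))
    exact ⟨⟨h4, fun i => h2 i ((T.t_strictMono.monotone (Nat.lt_succ_iff.mp i.2)).trans_lt h1)⟩, h1⟩
  · rintro ⟨⟨h1, h2⟩, h3⟩
    exact ⟨h3, fun i hi => h2 i⟩

lemma below_self (e : T.Edge) : Below e e := ⟨le_rfl, fun _ => rfl⟩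

lemma Below.eq_of_fst_eq {e e' : T.Edge} (h : Below e e') (h1 : e'.1 = e.1) : e' = e := by
  obtain ⟨n, c⟩ := e
  obtain ⟨m, d⟩ := e'
  obtain rfl : m = n := h1
  obtain ⟨h2, h3⟩ := h
  have : d = c := funext fun i => h3 i
  rw [this]

lemma measurableSet_above (e : T.Edge) : MeasurableSet (above e) := by
  have h : Measurable fun x : T.Point => x ∈ above e := by
    refine measurable_iff fun e' => ?_
    simp only [pt_mem_above]
    exact measurable_const.and
      (measurableSet_setOfPred.mp
        (measurableSet_lt measurable_const (measurable_height.comp (T.measurable_pt e'))))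
  simpa using h.setOf

/-- The function supported above `e` that depends on the height only and has the derivative `W`. -/
def liftFn (e : T.Edge) (W : ℝ → ℂ) : T.Point → ℂ :=
  (above e).indicator fun x => ∫ τ in (T.t e.1)..x.height, W τ

/-- The derivative of `liftFn`. -/
def liftDer (e : T.Edge) (W : ℝ → ℂ) : T.Point → ℂ := (above e).indicator fun x => W x.height

lemma measurable_liftDer (e : T.Edge) {W : ℝ → ℂ} (hW : Measurable W) : Measurable (liftDer e W) :=
  (hW.comp measurable_height).indicator (measurableSet_above e)

lemma norm_liftDer_le (e : T.Edge) {W : ℝ → ℂ} {K : ℝ} (hK : ∀ s, ‖W s‖ ≤ K) (x : T.Point) :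
    ‖liftDer e W x‖ ≤ K :=
  (norm_indicator_le_norm_self _ _).trans (hK _)

lemma liftDer_eq_zero (e : T.Edge) {W : ℝ → ℂ} {R : ℝ} (hR : ∀ s, R < s → W s = 0) (x : T.Point)
    (hx : R < x.height) : liftDer e W x = 0 := by
  unfold liftDer
  by_cases h : x ∈ above e
  · rw [Set.indicator_of_mem h, hR _ hx]
  · rw [Set.indicator_of_notMem h]

lemma memLp_liftDer (e : T.Edge) {W : ℝ → ℂ} (hW : Measurable W) {K R : ℝ}
    (hK : ∀ s, ‖W s‖ ≤ K) (hR : ∀ s, R < s → W s = 0) : MemLp (liftDer e W) 2 T.measure :=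
  memLp_of_bounded (measurable_liftDer e hW).aestronglyMeasurable (norm_liftDer_le e hK)
    (liftDer_eq_zero e hR)

lemma intervalIntegrable_of_bounded {W : ℝ → ℂ} (hW : Measurable W) {K : ℝ}
    (hK : ∀ s, ‖W s‖ ≤ K) (a b : ℝ) : IntervalIntegrable W volume a b := by
  rw [intervalIntegrable_iff]
  exact Measure.integrableOn_of_bounded (M := K) (by simp) hW.aestronglyMeasurable
    (Eventually.of_forall hK)

lemma liftFn_pt {e e' : T.Edge} (h : Below e e') (W : ℝ → ℂ) {s : ℝ} (hs : s ∈ T.edgeIcc e') :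
    liftFn e W (T.pt e' s) = ∫ τ in (T.t e.1)..s, W τ := by
  have hh := height_pt_of_mem hs
  have hle : T.t e.1 ≤ s := (T.t_strictMono.monotone h.1).trans hs.1
  rcases eq_or_lt_of_le hle with h1 | h1
  · rw [liftFn, Set.indicator_of_notMem]
    · rw [h1, intervalIntegral.integral_same]
    · rw [pt_mem_above, hh, h1]
      exact fun h => lt_irrefl _ h.2
  · rw [liftFn, Set.indicator_of_mem (pt_mem_above.mpr ⟨h, by rwa [hh]⟩), hh]

lemma liftDer_pt {e e' : T.Edge} (h : Below e e') (W : ℝ → ℂ) {s : ℝ} (hs : s ∈ T.edgeIcc e')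
    (hlt : T.t e.1 < s) : liftDer e W (T.pt e' s) = W s := by
  have hh := height_pt_of_mem hs
  rw [liftDer, Set.indicator_of_mem (pt_mem_above.mpr ⟨h, by rwa [hh]⟩), hh]

lemma exists_lift (e : T.Edge) {W : ℝ → ℂ} (hW : Measurable W) {K R : ℝ}
    (hK : ∀ s, ‖W s‖ ≤ K) (hR : ∀ s, R < s → W s = 0) :
    ∃ u : T.DirichletSpace, T.fn u = liftFn e W ∧
      T.der u = (memLp_liftDer e hW hK hR).toLp (liftDer e W) := by
  refine ⟨⟨(liftFn e W, (memLp_liftDer e hW hK hR).toLp (liftDer e W)), ?_⟩, rfl, rfl⟩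
  intro e' r hr s hs
  simp only
  rw [T.integral_pt_congr e' (MemLp.coeFn_toLp _) hr hs]
  have hI := intervalIntegrable_of_bounded hW hK
  by_cases h : Below e e'
  · rw [liftFn_pt h W hr, liftFn_pt h W hs, intervalIntegral.integral_interval_sub_left (hI _ _)
      (hI _ _)]
    refine intervalIntegral.integral_congr_ae (Eventually.of_forall fun τ hτ => ?_)
    have h1 : τ ∈ T.edgeIcc e' :=
      Set.ordConnected_Icc.uIcc_subset hr hs (Set.uIoc_subset_uIcc hτ)
    have h2 : T.t e.1 < τ :=
      ((T.t_strictMono.monotone h.1).trans (le_min hr.1 hs.1)).trans_lt hτ.1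
    exact (liftDer_pt h W h1 h2).symm
  · have h1 : ∀ s, liftFn e W (T.pt e' s) = 0 := fun s =>
      Set.indicator_of_notMem (fun hs => h (pt_mem_above.mp hs).1) _
    have h2 : ∀ s, liftDer e W (T.pt e' s) = 0 := fun s =>
      Set.indicator_of_notMem (fun hs => h (pt_mem_above.mp hs).1) _
    simp [h1, h2]

lemma liftFn_root (e : T.Edge) (W : ℝ → ℂ) : liftFn e W T.root = 0 :=
  Set.indicator_of_notMem (fun h => absurd h.1 (not_lt.mpr (T.t_nonneg _))) _

lemma mem_H1_of_bounded {u : T.DirichletSpace} {K R : ℝ} (hK : ∀ x, ‖T.fn u x‖ ≤ K)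
    (hR : ∀ x : T.Point, R < x.height → T.fn u x = 0) : u ∈ T.H1 :=
  memLp_of_bounded (measurable_fn u).aestronglyMeasurable hK hR

lemma mem_homH10 {u : T.DirichletSpace} : u ∈ T.homH10 ↔ T.fn u T.root = 0 := Iff.rfl

lemma norm_liftFn_le (e : T.Edge) {W : ℝ → ℂ} {K : ℝ} (hK : ∀ s, ‖W s‖ ≤ K) (x : T.Point) :
    ‖liftFn e W x‖ ≤ K * x.height := by
  have hK0 : 0 ≤ K := (norm_nonneg _).trans (hK 0)
  unfold liftFn
  by_cases h : x ∈ above e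
  · rw [Set.indicator_of_mem h]
    refine (intervalIntegral.norm_integral_le_of_norm_le_const fun s _ => hK s).trans ?_
    rw [abs_of_pos (sub_pos.mpr h.1)]
    exact mul_le_mul_of_nonneg_left (by linarith [T.t_nonneg e.1]) hK0
  · rw [Set.indicator_of_notMem h, norm_zero]
    exact mul_nonneg hK0 x.height_nonneg

/-- Compactly supported functions, radial in the subtree above an edge. -/
lemma exists_lift_mem_H10 (e : T.Edge) {W : ℝ → ℂ} (hW : Measurable W) {K R : ℝ}
    (hK : ∀ s, ‖W s‖ ≤ K) (hR : ∀ s, R < s → W s = 0)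
    (h0 : ∫ τ in (T.t e.1)..R, W τ = 0) :
    ∃ u ∈ T.H10, T.fn u = liftFn e W ∧
      T.der u = (memLp_liftDer e hW hK hR).toLp (liftDer e W) := by
  obtain ⟨u, hu, hd⟩ := exists_lift e hW hK hR
  have hI := intervalIntegrable_of_bounded hW hK
  have hK0 : 0 ≤ K := (norm_nonneg _).trans (hK 0)
  have hz : ∀ x : T.Point, R < x.height → T.fn u x = 0 := by
    intro x hx
    rw [hu, liftFn]
    by_cases h : x ∈ above e
    · rw [Set.indicator_of_mem h, ← intervalIntegral.integral_add_adjacent_intervals (hI _ R)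
        (hI R _), h0, zero_add]
      refine (intervalIntegral.integral_congr_ae (g := fun _ => 0)
        (Eventually.of_forall fun τ hτ => ?_)).trans (by simp)
      rw [Set.uIoc_of_le hx.le] at hτ
      exact hR τ hτ.1
    · exact Set.indicator_of_notMem h _
  refine ⟨u, ⟨mem_H1_of_bounded (K := K * |R|) (R := R) (fun x => ?_) hz, ?_⟩, hu, hd⟩
  · rcases lt_or_ge R x.height with h | h
    · rw [hz x h, norm_zero]; positivity
    · rw [hu]
      exact (norm_liftFn_le e hK x).trans
        (mul_le_mul_of_nonneg_left (h.trans (le_abs_self R)) hK0)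
  · rw [SetLike.mem_coe, mem_homH10, hu, liftFn_root]

lemma liftDer_pt_indicator_eq_zero {e e' : T.Edge} (hne : e' ≠ e) {S : Set ℝ}
    (hS : S ⊆ Set.Ioc (T.t e.1) (T.t (e.1 + 1))) {s : ℝ} (hs : s ∈ T.edgeIcc e')
    (hs1 : s ≠ T.t (e.1 + 1)) : liftDer e (S.indicator fun _ => 1) (T.pt e' s) = 0 := by
  unfold liftDer
  by_cases h : T.pt e' s ∈ above e
  · rw [Set.indicator_of_mem h, height_pt_of_mem hs, Set.indicator_of_notMem]
    intro hsS
    have hb := (pt_mem_above.mp h).1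
    have h2 : e.1 < e'.1 := lt_of_le_of_ne hb.1 fun h3 => hne (hb.eq_of_fst_eq h3.symm)
    exact hs1 (le_antisymm (hS hsS).2 ((T.t_strictMono.monotone h2).trans hs.1))
  · exact Set.indicator_of_notMem h _

/-- A lifted indicator of a subset of `e` is carried by `e` alone: higher edges can meet its support
only at a single parameter value, which is negligible. Pairing with it therefore tests `w` on `e`.
-/
lemma inner_lift_indicator (e : T.Edge) {S : Set ℝ} (hSm : MeasurableSet S)
    (hS : S ⊆ Set.Ioc (T.t e.1) (T.t (e.1 + 1)))
    (hm : MemLp (liftDer e (S.indicator fun _ => 1)) 2 T.measure) (w : Lp ℂ 2 T.measure) :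
    inner ℂ (hm.toLp (liftDer e (S.indicator fun _ => 1))) w = ∫ s in S, w (T.pt e s) := by
  set f := liftDer e (S.indicator fun _ => 1) with hf
  have hfm : Measurable f := measurable_liftDer e (measurable_const.indicator hSm)
  have hae : (fun x => inner ℂ (hm.toLp f x) (w x)) =ᵐ[T.measure] fun x => inner ℂ (f x) (w x) := by
    filter_upwards [hm.coeFn_toLp] with x hx
    rw [hx]
  have hint : Integrable (fun x => inner ℂ (f x) (w x)) T.measure :=
    (L2.integrable_inner (𝕜 := ℂ) (hm.toLp f) w).congr hae
  have hSicc : S ⊆ T.edgeIcc e := hS.trans Set.Ioc_subset_Icc_self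
  have hmap : ∀ e' : T.Edge, ∫ x, inner ℂ (f x) (w x) ∂((volume.restrict (T.edgeIcc e')).map (T.pt e'))
      = ∫ s in T.edgeIcc e', inner ℂ (f (T.pt e' s)) (w (T.pt e' s)) := fun e' =>
    integral_map (T.measurable_pt e').aemeasurable
      (hint.1.mono_measure (T.map_pt_le_measure e'))
  rw [L2.inner_def, integral_congr_ae hae]
  refine (integral_sum_measure
    (μ := fun e : T.Edge => (volume.restrict (T.edgeIcc e)).map (T.pt e)) hint).trans ?_
  rw [tsum_eq_single e]
  · rw [hmap, ← Set.inter_eq_self_of_subset_right hSicc, ← setIntegral_indicator hSm]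
    refine setIntegral_congr_ae measurableSet_Icc ?_
    have hne : ∀ᵐ s : ℝ, s ≠ T.t e.1 := Measure.ae_ne volume _
    filter_upwards [hne] with s hs1 hs
    have hlt : T.t e.1 < s := lt_of_le_of_ne hs.1 (Ne.symm hs1)
    rw [hf, liftDer_pt (below_self e) _ hs hlt]
    by_cases h : s ∈ S
    · simp [h]
    · simp [h]
  · intro e' he'
    rw [hmap]
    refine (setIntegral_congr_ae (g := fun _ => (0 : ℂ)) measurableSet_Icc ?_).trans (by simp)
    have hne : ∀ᵐ s : ℝ, s ≠ T.t (e.1 + 1) := Measure.ae_ne volume _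
    filter_upwards [hne] with s hs1 hs
    rw [hf, liftDer_pt_indicator_eq_zero he' hS hs hs1, inner_zero_left]

/-- The restriction to the subtree above `e` is dropped and the radial energy over the whole tree is
used instead; this loss is harmless. -/
lemma norm_lift_sq_le (e : T.Edge) {W : ℝ → ℂ} (hW : Measurable W)
    (hm : MemLp (liftDer e W) 2 T.measure) {c : ℝ} (hc : 0 ≤ c)
    (h : ∫⁻ s in Set.Ioi (0 : ℝ), ENNReal.ofReal (T.g₀ s) * ‖W s‖ₑ ^ 2 ≤ ENNReal.ofReal c) :
    ‖hm.toLp (liftDer e W)‖ ^ 2 ≤ c := by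
  rw [← ENNReal.ofReal_le_ofReal_iff hc, ofReal_norm_sq_Lp]
  refine le_trans ?_ h
  rw [← lintegral_radial (T := T) (hW.enorm.pow_const 2)]
  refine lintegral_mono_ae ?_
  filter_upwards [hm.coeFn_toLp] with x hx
  rw [hx, liftDer]
  gcongr
  exact enorm_indicator_le_enorm_self _ _

/-! ### Infinite reduced height excludes transience -/

lemma integrableOn_one_div_g₀ {S : Set ℝ} (hS : volume S < ⊤) :
    IntegrableOn (fun s => 1 / T.g₀ s) S := by
  refine Measure.integrableOn_of_bounded (M := 1) hS.ne
    (measurable_const.div measurable_g₀).aestronglyMeasurable (Eventually.of_forall fun s => ?_)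
  have h1 : 1 ≤ T.g₀ s := T.one_le_edgeCount _
  rw [Real.norm_of_nonneg (by positivity)]
  exact div_le_one_of_le₀ h1 (by linarith)

lemma exists_lt_integral_one_div_g₀ (h : ¬ IntegrableOn (fun s => 1 / T.g₀ s) (Set.Ioi 0))
    (a M : ℝ) : ∃ R, a < R ∧ M < ∫ s in a..R, 1 / T.g₀ s := by
  by_contra! hcon
  refine h ?_
  have h1 : IntegrableOn (fun s => 1 / T.g₀ s) (Set.Ioi a) := by
    refine integrableOn_Ioi_of_intervalIntegral_norm_bounded (l := atTop) (b := fun x : ℝ => x) M a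
      (fun i => integrableOn_one_div_g₀ (by simp)) tendsto_id ?_
    filter_upwards [eventually_gt_atTop a] with R hR
    refine le_of_eq_of_le ?_ (hcon R hR)
    refine intervalIntegral.integral_congr fun s _ => ?_
    exact Real.norm_of_nonneg (one_div_nonneg.mpr (T.g₀_pos s).le)
  have h2 : IntegrableOn (fun s => 1 / T.g₀ s) (Set.Ioc 0 a) := integrableOn_one_div_g₀ (by simp)
  exact (h2.union h1).mono_set fun s hs => by
    rcases le_or_gt s a with h | h
    · exact Or.inl ⟨hs, h⟩
    · exact Or.inr h

/-- If the reduced height is infinite, then any function in `L₂(Γ)` orthogonal to the derivatives of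
functions from `H^{1,0}(Γ)` has zero integrals over subsets of the edges. -/
lemma setIntegral_eq_zero_of_orthogonal (h : ¬ IntegrableOn (fun s => 1 / T.g₀ s) (Set.Ioi 0))
    {w : Lp ℂ 2 T.measure} (hw : ∀ u ∈ T.H10, inner ℂ (T.der u) w = 0) (e : T.Edge) {S : Set ℝ}
    (hSm : MeasurableSet S) (hS : S ⊆ Set.Ioc (T.t e.1) (T.t (e.1 + 1))) :
    ∫ s in S, w (T.pt e s) = 0 := by
  set a := T.t (e.1 + 1) with ha
  have ha0 : 0 < a := (T.t_nonneg e.1).trans_lt (T.t_lt_succ e.1)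
  set β := volume.real S with hβ
  have hβ0 : 0 ≤ β := measureReal_nonneg
  have hSfin : volume S < ⊤ := (measure_mono hS).trans_lt (by simp)
  set W₁ : ℝ → ℂ := S.indicator fun _ => 1 with hW₁
  have hW₁m : Measurable W₁ := measurable_const.indicator hSm
  have hW₁K : ∀ s, ‖W₁ s‖ ≤ 1 := fun s =>
    (norm_indicator_le_norm_self _ _).trans (by simp)
  have hW₁R : ∀ s, a < s → W₁ s = 0 := fun s hs =>
    Set.indicator_of_notMem (fun h => absurd (hS h).2 (not_le.mpr hs)) _
  have hm₁ := memLp_liftDer e hW₁m hW₁K hW₁R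
  rw [← inner_lift_indicator e hSm hS hm₁]
  set p := hm₁.toLp (liftDer e W₁) with hp
  have key : ∀ ε : ℝ, 0 < ε → ‖inner ℂ p w‖ ≤ ε * ‖w‖ := by
    intro ε hε
    -- The energy of the compensating function below will be at most `β ^ 2 / L`; divergence of the
    -- integral lets this fall below `ε ^ 2`.
    obtain ⟨R, haR, hL⟩ := exists_lt_integral_one_div_g₀ h a (β ^ 2 / ε ^ 2)
    set L := ∫ s in a..R, 1 / T.g₀ s with hLdef
    have hL0 : 0 < L := lt_of_le_of_lt (by positivity) hL
    -- It has the same mass `β` as `W₁`, so that `W₁ - W₂` has mean zero. A density proportional to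
    -- `1 / g₀` is the equality case of Cauchy–Schwarz for the energy weighted by `g₀`.
    set W₂ : ℝ → ℂ := (Set.Ioc a R).indicator fun s => ((β / (L * T.g₀ s) : ℝ) : ℂ) with hW₂
    have hW₂m : Measurable W₂ := by
      refine Measurable.indicator ?_ measurableSet_Ioc
      exact Complex.measurable_ofReal.comp
        (measurable_const.div (measurable_const.mul measurable_g₀))
    have hW₂K : ∀ s, ‖W₂ s‖ ≤ β / L := by
      intro s
      refine (norm_indicator_le_norm_self _ _).trans ?_
      have h1 : 1 ≤ T.g₀ s := T.one_le_edgeCount _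
      rw [Complex.norm_real, Real.norm_of_nonneg (by positivity)]
      exact div_le_div_of_nonneg_left hβ0 hL0 (le_mul_of_one_le_right hL0.le h1)
    have hW₂R : ∀ s, R < s → W₂ s = 0 := fun s hs =>
      Set.indicator_of_notMem (fun h => absurd h.2 (not_le.mpr hs)) _
    have hm₂ := memLp_liftDer e hW₂m hW₂K hW₂R
    set q := hm₂.toLp (liftDer e W₂) with hq
    have hi₁ := intervalIntegrable_of_bounded hW₁m hW₁K
    have hi₂ := intervalIntegrable_of_bounded hW₂m hW₂K
    have hta : T.t e.1 ≤ a := (T.t_lt_succ e.1).le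
    have hzero : ∫ τ in (T.t e.1)..R, (W₁ - W₂) τ = 0 := by
      simp only [Pi.sub_apply]
      rw [intervalIntegral.integral_sub (hi₁ _ _) (hi₂ _ _),
        intervalIntegral.integral_of_le (hta.trans haR.le),
        intervalIntegral.integral_of_le (hta.trans haR.le),
        setIntegral_indicator hSm, setIntegral_indicator measurableSet_Ioc,
        Set.inter_eq_self_of_subset_right (hS.trans (Set.Ioc_subset_Ioc_right haR.le)),
        Set.inter_eq_self_of_subset_right (Set.Ioc_subset_Ioc_left hta), integral_complex_ofReal]
      have h2 : ∫ s in Set.Ioc a R, β / (L * T.g₀ s) = β := by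
        have h3 : ∀ s, β / (L * T.g₀ s) = β / L * (1 / T.g₀ s) := fun s => by
          rw [div_mul_div_comm, mul_one]
        simp only [h3]
        rw [integral_const_mul, ← intervalIntegral.integral_of_le haR.le, ← hLdef,
          div_mul_cancel₀ _ hL0.ne']
      rw [h2]
      simp [hβ]
    obtain ⟨u, hu, -, hd⟩ := exists_lift_mem_H10 (T := T) e (W := W₁ - W₂) (K := 1 + β / L) (R := R)
      (hW₁m.sub hW₂m) (fun s => (norm_sub_le _ _).trans (add_le_add (hW₁K s) (hW₂K s)))
      (fun s hs => by simp [hW₁R s (haR.trans hs), hW₂R s hs]) hzero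
    have hpq : T.der u = p - q := by
      rw [hd, hp, hq, ← MemLp.toLp_sub]
      congr 1
      funext x
      by_cases hx : x ∈ above e
      · simp [liftDer, hx]
      · simp [liftDer, hx]
    have h4 : inner ℂ p w = inner ℂ q w := by
      have := hw u hu
      rwa [hpq, inner_sub_left, sub_eq_zero] at this
    have hqn : ‖q‖ ^ 2 ≤ β ^ 2 / L := by
      refine norm_lift_sq_le e hW₂m hm₂ (by positivity) ?_
      have h5 : ∀ s, ENNReal.ofReal (T.g₀ s) * ‖W₂ s‖ₑ ^ 2 = (Set.Ioc a R).indicator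
          (fun s => ENNReal.ofReal (β ^ 2 / L ^ 2 * (1 / T.g₀ s))) s := by
        intro s
        by_cases hs : s ∈ Set.Ioc a R
        · have hg := T.g₀_pos s
          rw [hW₂, Set.indicator_of_mem hs, Set.indicator_of_mem hs, ← ofReal_norm,
            ← ENNReal.ofReal_pow (norm_nonneg _), ← ENNReal.ofReal_mul hg.le, Complex.norm_real,
            Real.norm_eq_abs, sq_abs]
          congr 1
          field_simp
        · rw [hW₂, Set.indicator_of_notMem hs, Set.indicator_of_notMem hs]
          simp
      simp only [h5]
      refine (setLIntegral_le_lintegral _ _).trans ?_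
      rw [lintegral_indicator measurableSet_Ioc, ← ofReal_integral_eq_lintegral_ofReal,
        integral_const_mul, ← intervalIntegral.integral_of_le haR.le, ← hLdef]
      · refine ENNReal.ofReal_le_ofReal (le_of_eq ?_)
        field_simp
      · exact (integrableOn_one_div_g₀ (by simp)).const_mul _
      · exact Eventually.of_forall fun s =>
          mul_nonneg (by positivity) (one_div_nonneg.mpr (T.g₀_pos s).le)
    have h6 : ‖q‖ ≤ ε := by
      refine le_of_sq_le_sq (hqn.trans ?_) hε.le
      rw [div_le_iff₀ hL0]
      rw [div_lt_iff₀ (by positivity)] at hL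
      linarith
    rw [h4]
    exact (norm_inner_le_norm _ _).trans (mul_le_mul_of_nonneg_right h6 (norm_nonneg _))
  rw [← norm_le_zero_iff]
  refine le_of_forall_pos_le_add fun δ hδ => ?_
  have h7 := key (δ / (‖w‖ + 1)) (by positivity)
  rw [zero_add]
  refine h7.trans ?_
  rw [div_mul_eq_mul_div, div_le_iff₀ (by positivity)]
  nlinarith [norm_nonneg w]

/-- On a transient tree the reduced height is finite. -/
lemma IsTransient.integrableOn (hT : T.IsTransient) :
    IntegrableOn (fun s => 1 / T.g₀ s) (Set.Ioi 0) := by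
  by_contra h
  refine hT (le_antisymm inf_le_left fun u hu => ⟨hu, ?_⟩)
  -- The derivatives turn out to be dense in all of `L₂(Γ)`. As the norm of `u` is that of its
  -- derivative, this gives density of `H10`.
  have horth : (T.H10.map T.der)ᗮ = ⊥ := by
    rw [Submodule.eq_bot_iff]
    intro w hw
    have hw' : ∀ u ∈ T.H10, inner ℂ (T.der u) w = 0 := fun u hu => hw _ ⟨u, hu, rfl⟩
    have hedge : ∀ e : T.Edge, ∀ᵐ s ∂volume.restrict (T.edgeIcc e), w (T.pt e s) = 0 := by
      intro e
      refine Integrable.ae_eq_zero_of_forall_setIntegral_eq_zero (T.integrableOn_pt e w)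
        fun S hSm _ => ?_
      have hae : (S ∩ T.edgeIcc e : Set ℝ) =ᵐ[volume]
          (S ∩ Set.Ioc (T.t e.1) (T.t (e.1 + 1)) : Set ℝ) :=
        (ae_eq_refl S).inter Ioc_ae_eq_Icc.symm
      rw [Measure.restrict_restrict hSm, setIntegral_congr_set hae]
      exact setIntegral_eq_zero_of_orthogonal h hw' e (hSm.inter measurableSet_Ioc)
        Set.inter_subset_right
    have h0 : ENNReal.ofReal (‖w‖ ^ 2) = 0 := by
      rw [ofReal_norm_sq_Lp, lintegral_measure
        ((Lp.aestronglyMeasurable w).enorm.pow_const 2), ENNReal.tsum_eq_zero]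
      intro n
      refine Finset.sum_eq_zero fun c _ => ?_
      refine (lintegral_congr_ae (g := fun _ => 0) ?_).trans lintegral_zero
      filter_upwards [hedge ⟨n, c⟩] with s hs
      simp [hs]
    have h1 : ‖w‖ ^ 2 ≤ 0 := ENNReal.ofReal_eq_zero.mp h0
    exact norm_eq_zero.mp (by nlinarith [norm_nonneg w])
  have htop := Submodule.topologicalClosure_eq_top_iff.mpr horth
  have hu' : T.der u ∈ (T.H10.map T.der).topologicalClosure := htop ▸ Submodule.mem_top
  change u ∈ closure (T.H10 : Set T.DirichletSpace)
  rw [Metric.mem_closure_iff]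
  intro ε hε
  obtain ⟨_, ⟨v, hv, rfl⟩, hd⟩ := Metric.mem_closure_iff.mp hu' ε hε
  refine ⟨v, hv, ?_⟩
  rw [dist_eq_norm] at hd ⊢
  rwa [norm_eq_norm_der, map_sub]

/-! ### Level averages and the value at the root -/

lemma sum_parent {n : ℕ} (f : (∀ i : Fin (n + 1), Fin (T.b i)) → ℂ) :
    ∑ c : (∀ i : Fin (n + 1 + 1), Fin (T.b i)), f (parent c) = T.b (n + 1) * ∑ c, f c := by
  let α : Fin (n + 1 + 1) → Type := fun i => Fin (T.b i)
  have h := Fintype.sum_equiv (Fin.snocEquiv α)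
    (fun p : α (Fin.last (n + 1)) × (∀ i : Fin (n + 1), α i.castSucc) => f p.2)
    (fun c => f (parent c)) (fun p => by
      congr 1
      funext i
      simp [parent, Fin.snocEquiv, Fin.snoc_castSucc])
  rw [← h, Fintype.sum_prod_type]
  simp only [Finset.sum_const, Finset.card_univ, nsmul_eq_mul]
  congr 2
  simp [α]

/-- The average of a function over the points of height `s` on the edges of generation `n`. -/
def avg (u : T.Point → ℂ) (n : ℕ) (s : ℝ) : ℂ :=
  ((1 / T.edgeCount n : ℝ) : ℂ) * ∑ c : (∀ i : Fin (n + 1), Fin (T.b i)), u (T.pt ⟨n, c⟩ s)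

/-- Every vertex of generation `n + 1` is the lower end of the same number of edges, so passing to
those edges does not change the average. -/
lemma avg_succ (u : T.Point → ℂ) (n : ℕ) : avg u (n + 1) (T.t (n + 1)) = avg u n (T.t (n + 1)) := by
  have hb : (T.b (n + 1) : ℂ) ≠ 0 := by exact_mod_cast (T.b_pos _).ne'
  have hg : (T.edgeCount n : ℂ) ≠ 0 := by exact_mod_cast (T.edgeCount_pos _).ne'
  have h : ∀ c : (∀ i : Fin (n + 1 + 1), Fin (T.b i)),
      u (T.pt ⟨n + 1, c⟩ (T.t (n + 1))) = u (T.pt ⟨n, parent c⟩ (T.t (n + 1))) := fun c => by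
    rw [pt_parent c le_rfl]
  rw [avg, avg, Finset.sum_congr rfl fun c _ => h c,
    sum_parent fun c => u (T.pt ⟨n, c⟩ (T.t (n + 1))), edgeCount_succ]
  push_cast
  field_simp

lemma avg_zero (u : T.Point → ℂ) : avg u 0 (T.t 0) = u T.root := by
  have h1 : T.edgeCount 0 = 1 := by simp [edgeCount, T.b_zero]
  have h2 : ∀ c : (∀ i : Fin (0 + 1), Fin (T.b i)), u (T.pt ⟨0, c⟩ (T.t 0)) = u T.root := by
    intro c
    rw [T.t_zero, pt_zero_left]
  rw [avg, Finset.sum_congr rfl fun c _ => h2 c, Finset.sum_const, Finset.card_univ, nsmul_eq_mul]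
  have h3 := T.card_branches 0
  rw [h1] at h3
  have h4 : (Fintype.card (∀ i : Fin (0 + 1), Fin (T.b i)) : ℂ) = 1 := by exact_mod_cast h3
  rw [h4, h1]
  simp

/-- The contribution of the edges of generation `n` to `∫ |v| / g₀ dx`. -/
def levelMass (v : T.Point → ℂ) (n : ℕ) : ENNReal :=
  ENNReal.ofReal (1 / T.edgeCount n) * ∑ c : (∀ i : Fin (n + 1), Fin (T.b i)),
    ∫⁻ s in Set.Icc (T.t n) (T.t (n + 1)), ‖v (T.pt ⟨n, c⟩ s)‖ₑ

lemma tsum_levelMass {v : T.Point → ℂ} (hv : Measurable v) :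
    ∑' n, levelMass v n =
      ∫⁻ x, ‖v x‖ₑ * ENNReal.ofReal (1 / T.g₀ x.height) ∂T.measure := by
  have hg : Measurable fun x : T.Point => ENNReal.ofReal (1 / T.g₀ x.height) :=
    (measurable_const.div (measurable_g₀.comp measurable_height)).ennreal_ofReal
  rw [lintegral_measure (F := fun x => ‖v x‖ₑ * ENNReal.ofReal (1 / T.g₀ x.height))
    (hv.enorm.mul hg).aemeasurable]
  refine tsum_congr fun n => ?_
  rw [levelMass, Finset.mul_sum]
  refine Finset.sum_congr rfl fun c _ => ?_
  have hm : Measurable fun s => ‖v (T.pt ⟨n, c⟩ s)‖ₑ := (hv.comp (T.measurable_pt _)).enorm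
  rw [← lintegral_const_mul _ hm]
  refine setLIntegral_congr_fun_ae measurableSet_Icc ?_
  have hne : ∀ᵐ s : ℝ, s ≠ T.t n := Measure.ae_ne volume _
  filter_upwards [hne] with s hs1 hs
  rw [height_pt_of_mem (e := ⟨n, c⟩) hs, T.g₀_eq ⟨lt_of_le_of_ne hs.1 (Ne.symm hs1), hs.2⟩, mul_comm]

lemma lintegral_one_div_g₀_sq (hI : IntegrableOn (fun s => 1 / T.g₀ s) (Set.Ioi 0)) :
    ∫⁻ x : T.Point, ENNReal.ofReal (1 / T.g₀ x.height) ^ 2 ∂T.measure =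
      ENNReal.ofReal T.reducedHeight := by
  rw [lintegral_radial (f := fun s => ENNReal.ofReal (1 / T.g₀ s) ^ 2)
    ((measurable_const.div measurable_g₀).ennreal_ofReal.pow_const 2), reducedHeight,
    ofReal_integral_eq_lintegral_ofReal hI
      (Eventually.of_forall fun s => one_div_nonneg.mpr (T.g₀_pos s).le)]
  refine lintegral_congr fun s => ?_
  have hg := T.g₀_pos s
  rw [← ENNReal.ofReal_pow (by positivity), ← ENNReal.ofReal_mul hg.le]
  congr 1
  field_simp

/-- Cauchy–Schwarz against `1 / g₀`, whose squared norm on the tree is `∫ g₀ / g₀² = l(Γ)`. It is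
applied both to the derivative and to the function itself. -/
lemma tsum_levelMass_le (hI : IntegrableOn (fun s => 1 / T.g₀ s) (Set.Ioi 0)) {v : T.Point → ℂ}
    (hv : Measurable v) : ∑' n, levelMass v n ≤
      (∫⁻ x, ‖v x‖ₑ ^ 2 ∂T.measure) ^ (1 / 2 : ℝ) *
        ENNReal.ofReal T.reducedHeight ^ (1 / 2 : ℝ) := by
  have hg : Measurable fun x : T.Point => ENNReal.ofReal (1 / T.g₀ x.height) :=
    (measurable_const.div (measurable_g₀.comp measurable_height)).ennreal_ofReal
  rw [tsum_levelMass hv, ← lintegral_one_div_g₀_sq hI]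
  have h := ENNReal.lintegral_mul_le_Lp_mul_Lq T.measure Real.HolderConjugate.two_two
    hv.enorm.aemeasurable hg.aemeasurable
  simpa using h

lemma enorm_avg_sub_le (u : T.DirichletSpace) (n : ℕ) {s : ℝ}
    (hs : s ∈ Set.Icc (T.t n) (T.t (n + 1))) :
    ‖avg (T.fn u) n s - avg (T.fn u) n (T.t n)‖ₑ ≤ levelMass (T.der u) n := by
  have h0 : T.t n ∈ Set.Icc (T.t n) (T.t (n + 1)) := ⟨le_rfl, (T.t_lt_succ n).le⟩
  rw [avg, avg, ← mul_sub, ← Finset.sum_sub_distrib, enorm_mul, levelMass]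
  have h1 : ‖((1 / T.edgeCount n : ℝ) : ℂ)‖ₑ = ENNReal.ofReal (1 / T.edgeCount n) := by
    rw [← ofReal_norm, Complex.norm_real,
      Real.norm_of_nonneg (one_div_nonneg.mpr (T.edgeCount_pos n).le)]
  rw [h1]
  gcongr
  refine (enorm_sum_le _ _).trans (Finset.sum_le_sum fun c _ => ?_)
  rw [fn_pt_sub u ⟨n, c⟩ h0 hs, intervalIntegral.integral_of_le hs.1]
  refine (enorm_integral_le_lintegral_enorm _).trans ?_
  exact lintegral_mono_set (Set.Ioc_subset_Icc_self.trans (Set.Icc_subset_Icc_right hs.2))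

lemma enorm_avg_sub_root_le (u : T.DirichletSpace) (n : ℕ) {s : ℝ}
    (hs : s ∈ Set.Icc (T.t n) (T.t (n + 1))) :
    ‖avg (T.fn u) n s - T.fn u T.root‖ₑ ≤
      ∑ k ∈ Finset.range (n + 1), levelMass (T.der u) k := by
  induction n generalizing s with
  | zero =>
    rw [← avg_zero (T.fn u)]
    simpa using enorm_avg_sub_le u 0 hs
  | succ n ih =>
    rw [Finset.sum_range_succ]
    have h1 := ih (s := T.t (n + 1)) ⟨(T.t_lt_succ n).le, le_rfl⟩
    rw [← avg_succ] at h1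
    have h2 := enorm_avg_sub_le u (n + 1) hs
    have h3 : avg (T.fn u) (n + 1) s - T.fn u T.root =
        (avg (T.fn u) (n + 1) (T.t (n + 1)) - T.fn u T.root) +
        (avg (T.fn u) (n + 1) s - avg (T.fn u) (n + 1) (T.t (n + 1))) := by ring
    rw [h3]
    exact (enorm_add_le _ _).trans (add_le_add h1 h2)

lemma reducedHeight_nonneg : 0 ≤ T.reducedHeight :=
  setIntegral_nonneg measurableSet_Ioi fun s _ => one_div_nonneg.mpr (T.g₀_pos s).le

lemma lintegral_enorm_avg_le {v : T.Point → ℂ} (hv : Measurable v) (n : ℕ) :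
    ∫⁻ s in Set.Icc (T.t n) (T.t (n + 1)), ‖avg v n s‖ₑ ≤ levelMass v n := by
  have h1 : ‖((1 / T.edgeCount n : ℝ) : ℂ)‖ₑ = ENNReal.ofReal (1 / T.edgeCount n) := by
    rw [← ofReal_norm, Complex.norm_real,
      Real.norm_of_nonneg (one_div_nonneg.mpr (T.edgeCount_pos n).le)]
  have hm : ∀ c : (∀ i : Fin (n + 1), Fin (T.b i)), Measurable fun s => ‖v (T.pt ⟨n, c⟩ s)‖ₑ :=
    fun c => (hv.comp (T.measurable_pt _)).enorm
  rw [levelMass, ← lintegral_finsetSum _ fun c _ => hm c,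
    ← lintegral_const_mul _ (Finset.measurable_fun_sum _ fun c _ => hm c)]
  refine lintegral_mono fun s => ?_
  rw [avg, enorm_mul, h1]
  gcongr
  exact enorm_sum_le _ _

/-- On a tree of finite reduced height, the value at the root of a function from `H¹(Γ)` is
controlled by its norm. -/
lemma norm_fn_root_le (hI : IntegrableOn (fun s => 1 / T.g₀ s) (Set.Ioi 0))
    {u : T.DirichletSpace} (hu : u ∈ T.H1) :
    ‖T.fn u T.root‖ ≤ √T.reducedHeight * ‖u‖ := by
  by_contra! hlt
  set c := ‖T.fn u T.root‖ - √T.reducedHeight * ‖u‖ with hc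
  have hc0 : 0 < c := sub_pos.mpr hlt
  have hl := T.reducedHeight_nonneg
  have hD : ∑' n, levelMass (T.der u) n ≤ ENNReal.ofReal (√T.reducedHeight * ‖u‖) := by
    refine (tsum_levelMass_le hI (Lp.stronglyMeasurable _).measurable).trans (le_of_eq ?_)
    rw [← ofReal_norm_sq_Lp, ENNReal.ofReal_rpow_of_nonneg (by positivity) (by norm_num),
      ENNReal.ofReal_rpow_of_nonneg hl (by norm_num), ← Real.sqrt_eq_rpow, ← Real.sqrt_eq_rpow,
      Real.sqrt_sq (norm_nonneg _), ← ENNReal.ofReal_mul (norm_nonneg _), mul_comm]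
    rfl
  -- The averages differ from the root value by at most `√l ‖u‖`, so all of them have modulus at
  -- least `c`.
  have havg : ∀ n, ∀ s ∈ Set.Icc (T.t n) (T.t (n + 1)), ENNReal.ofReal c ≤ ‖avg (T.fn u) n s‖ₑ := by
    intro n s hs
    have h1 := ((enorm_avg_sub_root_le u n hs).trans (ENNReal.sum_le_tsum _)).trans hD
    rw [← ofReal_norm, ENNReal.ofReal_le_ofReal_iff (by positivity)] at h1
    rw [← ofReal_norm]
    refine ENNReal.ofReal_le_ofReal ?_
    have h2 := norm_sub_norm_le (T.fn u T.root) (avg (T.fn u) n s)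
    rw [norm_sub_rev] at h2
    linarith
  have hfin : ∑' n, levelMass (T.fn u) n < ⊤ := by
    refine (tsum_levelMass_le hI (measurable_fn u)).trans_lt ?_
    refine ENNReal.mul_lt_top (ENNReal.rpow_lt_top_of_nonneg (by norm_num) ?_)
      (ENNReal.rpow_lt_top_of_nonneg (by norm_num) ENNReal.ofReal_ne_top)
    have h := eLpNorm_nnreal_pow_eq_lintegral (f := T.fn u) (μ := T.measure) (p := 2) (by norm_num)
    have h' : ∫⁻ x, ‖T.fn u x‖ₑ ^ 2 ∂T.measure = eLpNorm (T.fn u) 2 T.measure ^ 2 := by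
      simpa using h.symm
    rw [h']
    exact ENNReal.pow_ne_top (show MemLp (T.fn u) 2 T.measure from hu).2.ne
  set B := ∑' n, levelMass (T.fn u) n with hB
  -- Integrating `c ≤ |avg|` up to height `t N` gives `c * t N`, which is unbounded in `N`, whereas
  -- `B` is finite.
  have hsum : ∀ N, ENNReal.ofReal (c * T.t N) ≤ B := by
    intro N
    refine le_trans ?_ (ENNReal.sum_le_tsum (Finset.range N))
    have h1 : c * T.t N = ∑ n ∈ Finset.range N, c * (T.t (n + 1) - T.t n) := by
      rw [← Finset.mul_sum, Finset.sum_range_sub, T.t_zero, sub_zero]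
    rw [h1, ENNReal.ofReal_sum_of_nonneg fun n _ =>
      mul_nonneg hc0.le (sub_nonneg.mpr (T.t_lt_succ n).le)]
    refine Finset.sum_le_sum fun n _ => ?_
    refine le_trans ?_ (lintegral_enorm_avg_le (measurable_fn u) n)
    calc ENNReal.ofReal (c * (T.t (n + 1) - T.t n))
        = ∫⁻ s in Set.Icc (T.t n) (T.t (n + 1)), ENNReal.ofReal c := by
          rw [setLIntegral_const, Real.volume_Icc, ENNReal.ofReal_mul hc0.le]
      _ ≤ _ := setLIntegral_mono' measurableSet_Icc (havg n)
  obtain ⟨N, hN⟩ := T.t_unbounded (B.toReal / c)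
  rw [div_lt_iff₀ hc0] at hN
  have h2 := ENNReal.toReal_mono hfin.ne (hsum N)
  rw [ENNReal.toReal_ofReal (mul_nonneg hc0.le (T.t_nonneg N))] at h2
  linarith

/-! ### The homogeneous space as a Hilbert space of functions -/

lemma H1_le_homH : T.H1 ≤ T.homH := fun u hu =>
  ⟨fun _ => u, fun _ => hu, tendsto_const_nhds, fun _ => tendsto_const_nhds⟩

lemma norm_fn_root_le_of_mem_homH (hI : IntegrableOn (fun s => 1 / T.g₀ s) (Set.Ioi 0))
    {u : T.DirichletSpace} (hu : u ∈ T.homH) :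
    ‖T.fn u T.root‖ ≤ √T.reducedHeight * ‖u‖ := by
  obtain ⟨q, hq, hqu, hqx⟩ := hu
  exact le_of_tendsto_of_tendsto' (hqx T.root).norm (hqu.norm.const_mul _)
    fun n => norm_fn_root_le hI (hq n)

lemma exists_norm_fn_le_of_mem_homH (hI : IntegrableOn (fun s => 1 / T.g₀ s) (Set.Ioi 0))
    (x : T.Point) : ∃ C : ℝ, 0 ≤ C ∧ ∀ u ∈ T.homH, ‖T.fn u x‖ ≤ C * ‖u‖ := by
  obtain ⟨C, hC, h⟩ := exists_norm_fn_le x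
  refine ⟨√T.reducedHeight + C, by positivity, fun u hu => ?_⟩
  rw [add_mul]
  exact (h u).trans (add_le_add_left (norm_fn_root_le_of_mem_homH hI hu) _)

lemma DirichletSpace.ext {u v : T.DirichletSpace} (h1 : T.fn u = T.fn v) (h2 : T.der u = T.der v) :
    u = v := Subtype.ext (Prod.ext h1 h2)

/-- Constants have zero seminorm, but bounded point evaluations keep the nonzero ones out of `homH`.
-/
lemma eq_zero_of_norm_eq_zero (hI : IntegrableOn (fun s => 1 / T.g₀ s) (Set.Ioi 0))
    (u : T.homH) (hu : ‖u‖ = 0) : u = 0 := by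
  have hu' : ‖(u : T.DirichletSpace)‖ = 0 := hu
  refine Subtype.ext (DirichletSpace.ext (funext fun x => ?_) ?_)
  · obtain ⟨C, -, h⟩ := exists_norm_fn_le_of_mem_homH hI x
    have h1 := h u u.2
    rw [hu', mul_zero] at h1
    simpa using h1
  · rw [norm_eq_norm_der] at hu'
    simpa using hu'

/-- The integral over a part of an edge depends continuously on the function in `L₂(Γ)`. -/
lemma tendsto_integral_pt (e : T.Edge) {r s : ℝ} (hr : r ∈ T.edgeIcc e) (hs : s ∈ T.edgeIcc e)
    {w : ℕ → Lp ℂ 2 T.measure} {w₀ : Lp ℂ 2 T.measure} (hw : Tendsto w atTop (𝓝 w₀)) :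
    Tendsto (fun n => ∫ τ in r..s, w n (T.pt e τ)) atTop (𝓝 (∫ τ in r..s, w₀ (T.pt e τ))) := by
  obtain ⟨C, hC, h⟩ := exists_integral_pt_le e
  rw [tendsto_iff_norm_sub_tendsto_zero] at hw ⊢
  refine squeeze_zero (fun _ => norm_nonneg _) (fun n => ?_) (by simpa using hw.const_mul C)
  have h1 := h (w n - w₀) r hr s hs
  rw [T.integral_pt_congr e (Lp.coeFn_sub (w n) w₀) hr hs] at h1
  simp only [Pi.sub_apply] at h1
  rwa [intervalIntegral.integral_sub (T.intervalIntegrable_pt e _ hr hs)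
    (T.intervalIntegrable_pt e _ hr hs)] at h1

lemma completeSpace_homH (hI : IntegrableOn (fun s => 1 / T.g₀ s) (Set.Ioi 0)) :
    CompleteSpace T.homH := by
  refine UniformSpace.complete_of_cauchySeq_tendsto fun u hu => ?_
  have hC := fun x => exists_norm_fn_le_of_mem_homH hI x
  choose C hC0 hC using hC
  have hcx : ∀ x, ∃ z, Tendsto (fun n => T.fn (u n) x) atTop (𝓝 z) := by
    intro x
    let f : T.homH →L[ℂ] ℂ :=
      (((LinearMap.proj x).comp T.fn).comp T.homH.subtype).mkContinuous (C x) fun v => hC x v v.2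
    exact cauchySeq_tendsto_of_complete (hu.map f.uniformContinuous)
  choose f hf using hcx
  obtain ⟨w, hw⟩ : ∃ w, Tendsto (fun n => T.der (u n)) atTop (𝓝 w) := by
    let g : T.homH →L[ℂ] Lp ℂ 2 T.measure :=
      (T.der.comp T.homH.subtype).mkContinuous 1 fun v => by
        rw [one_mul]
        exact le_of_eq rfl
    exact cauchySeq_tendsto_of_complete (hu.map g.uniformContinuous)
  let v : T.DirichletSpace := ⟨(f, w), fun e r hr s hs => by
    refine tendsto_nhds_unique ?_ (tendsto_integral_pt e hr hs hw)
    exact ((hf _).sub (hf _)).congr fun n => fn_pt_sub (u n) e hr hs⟩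
  have hv : Tendsto (fun n => (u n : T.DirichletSpace)) atTop (𝓝 v) := by
    rw [tendsto_iff_norm_sub_tendsto_zero] at hw ⊢
    refine hw.congr fun n => ?_
    rw [norm_eq_norm_der, map_sub]
    rfl
  -- Diagonal choice: approximants from `H1` to the members of the Cauchy sequence. Their pointwise
  -- convergence follows from norm convergence, since the differences lie in `homH`.
  have hq : ∀ n, ∃ q ∈ T.H1, ‖q - u n‖ < 1 / ((n : ℝ) + 1) := by
    intro n
    obtain ⟨q, hq, hqu, -⟩ := (u n).2
    rw [tendsto_iff_norm_sub_tendsto_zero] at hqu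
    obtain ⟨m, hm⟩ := (hqu.eventually (gt_mem_nhds (show (0 : ℝ) < 1 / ((n : ℝ) + 1) by
      positivity))).exists
    exact ⟨q m, hq m, hm⟩
  choose q hq hqn using hq
  have hqn0 : Tendsto (fun n => ‖q n - u n‖) atTop (𝓝 0) :=
    squeeze_zero (fun _ => norm_nonneg _) (fun n => (hqn n).le) tendsto_one_div_add_atTop_nhds_zero_nat
  have hvm : v ∈ T.homH := by
    refine ⟨q, hq, ?_, fun x => ?_⟩
    · rw [tendsto_iff_norm_sub_tendsto_zero] at hv ⊢
      refine squeeze_zero (fun _ => norm_nonneg _) (fun n => ?_) (by simpa using hqn0.add hv)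
      exact norm_sub_le_norm_sub_add_norm_sub _ _ _
    · have h1 : Tendsto (fun n => T.fn (q n - u n) x) atTop (𝓝 0) := by
        rw [tendsto_zero_iff_norm_tendsto_zero]
        exact squeeze_zero (fun _ => norm_nonneg _)
          (fun n => hC x _ (T.homH.sub_mem (H1_le_homH (hq n)) (u n).2))
          (by simpa using hqn0.const_mul (C x))
      have h2 := h1.add (hf x)
      simp only [map_sub, Pi.sub_apply, sub_add_cancel, zero_add] at h2
      exact h2
  refine ⟨⟨v, hvm⟩, ?_⟩
  rw [tendsto_iff_norm_sub_tendsto_zero] at hv ⊢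
  exact hv

/-! ### Codimension one -/

/-- The constant functions. -/
def constFn (c : ℂ) : T.DirichletSpace :=
  ⟨(fun _ => c, 0), fun e r hr s hs => by
    simp only
    rw [T.integral_pt_congr e (Lp.coeFn_zero ℂ 2 T.measure) hr hs]
    simp⟩

/-- The edge emanating from the root. -/
def firstEdge (T : RegularTree) : T.Edge := ⟨0, fun i => ⟨0, T.b_pos i⟩⟩

/-- The root has a single branch, because `b 0 = 1`. -/
lemma mem_above_firstEdge {x : T.Point} (hx : 0 < x.height) : x ∈ above T.firstEdge := by
  refine ⟨T.t_zero.trans_lt hx, fun i hi => ?_⟩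
  obtain ⟨i, hi'⟩ := i
  obtain rfl : i = 0 := by simpa [firstEdge] using hi'
  have : Subsingleton (Fin (T.b 0)) := by rw [T.b_zero]; infer_instance
  exact Subsingleton.elim (α := Fin (T.b 0)) _ _

/-- A function with value `1` at the root, supported on the edge emanating from the root. -/
lemma exists_rootFn (T : RegularTree) : ∃ η ∈ T.H1, T.fn η T.root = 1 ∧ (∀ x, ‖T.fn η x‖ ≤ 1) ∧
    (∀ x, x ∉ T.rootEdge → T.fn η x = 0) ∧ ‖η‖ ^ 2 ≤ 1 / T.t 1 := by
  have ht := T.t_one_pos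
  -- The function is `1 - min |x| t₁ / t₁`: constant slope on the root edge, hence energy `1 / t₁`.
  set W : ℝ → ℂ := (Set.Ioc 0 (T.t 1)).indicator fun _ => ((-(1 / T.t 1) : ℝ) : ℂ) with hW
  have hWm : Measurable W := measurable_const.indicator measurableSet_Ioc
  have hWK : ∀ s, ‖W s‖ ≤ 1 / T.t 1 := by
    intro s
    refine (norm_indicator_le_norm_self _ _).trans ?_
    rw [Complex.norm_real, norm_neg, Real.norm_of_nonneg (by positivity)]
  have hWR : ∀ s, T.t 1 < s → W s = 0 := fun s hs =>
    Set.indicator_of_notMem (fun h => absurd h.2 (not_le.mpr hs)) _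
  obtain ⟨u, hu, hd⟩ := exists_lift T.firstEdge hWm hWK hWR
  have hval : ∀ x, T.fn (constFn 1 + u) x = ((1 - min x.height (T.t 1) / T.t 1 : ℝ) : ℂ) := by
    intro x
    have h1 : T.fn (constFn 1 + u) x = 1 + liftFn T.firstEdge W x := by
      rw [map_add, Pi.add_apply, hu]
      rfl
    have h0 := x.height_nonneg
    have h2 : liftFn T.firstEdge W x = ((-(min x.height (T.t 1) / T.t 1) : ℝ) : ℂ) := by
      rcases eq_or_lt_of_le h0 with h | h
      · rw [← h, min_eq_left ht.le, liftFn, Set.indicator_of_notMem]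
        · simp
        · exact fun hx => absurd hx.1 (by rw [← h]; exact not_lt.mpr (T.t_nonneg _))
      · rw [liftFn, Set.indicator_of_mem (mem_above_firstEdge h)]
        change ∫ τ in (T.t 0)..x.height, W τ = _
        rw [T.t_zero, intervalIntegral.integral_of_le h0, hW, setIntegral_indicator measurableSet_Ioc,
          Set.Ioc_inter_Ioc, setIntegral_const]
        have h3 : 0 ≤ min x.height (T.t 1) := le_min h0 ht.le
        rw [max_self, Real.volume_real_Ioc_of_le h3, sub_zero, Complex.real_smul, ← Complex.ofReal_mul]
        congr 1
        ring
    rw [h1, h2]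
    push_cast
    ring
  have hb : ∀ x, ‖T.fn (constFn 1 + u) x‖ ≤ 1 := by
    intro x
    have h3 : 0 ≤ min x.height (T.t 1) := le_min x.height_nonneg ht.le
    have h4 : min x.height (T.t 1) / T.t 1 ≤ 1 := div_le_one_of_le₀ (min_le_right _ _) ht.le
    have h5 : 0 ≤ min x.height (T.t 1) / T.t 1 := by positivity
    rw [hval, Complex.norm_real, Real.norm_of_nonneg (by linarith)]
    linarith
  have hz : ∀ x : T.Point, T.t 1 < x.height → T.fn (constFn 1 + u) x = 0 := by
    intro x hx
    rw [hval, min_eq_right hx.le, div_self ht.ne']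
    simp
  refine ⟨constFn 1 + u, mem_H1_of_bounded hb hz, ?_, hb, fun x hx => hz x (not_le.mp hx), ?_⟩
  · rw [hval]
    simp [root, ht.le]
  · have h1 : ‖constFn 1 + u‖ = ‖T.der u‖ := by
      rw [norm_eq_norm_der, map_add]
      change ‖0 + T.der u‖ = _
      rw [zero_add]
    rw [h1, hd]
    refine norm_lift_sq_le _ hWm _ (by positivity) ?_
    have h2 : ∀ s ∈ Set.Ioi (0 : ℝ), ENNReal.ofReal (T.g₀ s) * ‖W s‖ₑ ^ 2 =
        (Set.Ioc 0 (T.t 1)).indicator (fun _ => ENNReal.ofReal ((1 / T.t 1) ^ 2)) s := by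
      intro s hs
      by_cases h : s ∈ Set.Ioc 0 (T.t 1)
      · have hg : T.g₀ s = 1 := by
          rw [T.g₀_eq (n := 0) (by rwa [T.t_zero])]
          simp [edgeCount, T.b_zero]
        rw [hg, hW, Set.indicator_of_mem h, Set.indicator_of_mem h, ← ofReal_norm,
          Complex.norm_real, norm_neg, Real.norm_of_nonneg (by positivity),
          ← ENNReal.ofReal_pow (by positivity)]
        simp
      · rw [hW, Set.indicator_of_notMem h, Set.indicator_of_notMem h]
        simp
    rw [setLIntegral_congr_fun measurableSet_Ioi h2]
    refine (setLIntegral_le_lintegral _ _).trans ?_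
    rw [lintegral_indicator measurableSet_Ioc, setLIntegral_const, Real.volume_Ioc,
      ← ENNReal.ofReal_mul (by positivity)]
    refine ENNReal.ofReal_le_ofReal (le_of_eq ?_)
    field_simp
    ring

/-- Subtracting the root value times `η` turns approximants from `H1` into approximants from `H10`;
the coefficients converge because convergence in `homH` includes the root. -/
lemma sub_smul_mem_homH0 {η u : T.DirichletSpace} (hη : η ∈ T.H1) (hη1 : T.fn η T.root = 1)
    (hu : u ∈ T.homH) : u - T.fn u T.root • η ∈ T.homH0 := by
  have hroot : ∀ v : T.DirichletSpace, v - T.fn v T.root • η ∈ T.homH10 := fun v => by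
    rw [mem_homH10]
    simp [hη1]
  obtain ⟨q, hq, hqu, hqx⟩ := hu
  refine ⟨hroot u, ?_⟩
  change _ ∈ closure (T.H10 : Set T.DirichletSpace)
  refine mem_closure_of_tendsto (hqu.sub ((hqx T.root).smul_const η)) (Eventually.of_forall fun n => ?_)
  exact ⟨T.H1.sub_mem (hq n) (T.H1.smul_mem _ hη), hroot _⟩

end RegularTree

/-! ### Polynomial lower bound for the singular numbers -/

/-- Subdivision of an interval into parts of equal mass, for a density bounded by `1`. -/
lemma exists_equal_mass_points {a b : ℝ} (hab : a ≤ b) {v : ℝ → ℝ}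
    (hv : IntegrableOn v (Set.Icc a b)) (h0 : ∀ s, 0 ≤ v s) (h1 : ∀ s, v s ≤ 1)
    (hM : 0 < ∫ s in a..b, v s) {m : ℕ} (hm : 0 < m) :
    ∃ x : ℕ → ℝ, (∀ i ≤ m, x i ∈ Set.Icc a b) ∧
      (∀ i < m, (∫ s in a..b, v s) / m ≤ x (i + 1) - x i) ∧
      (∀ i < m, ∫ s in (x i)..(x (i + 1)), v s = (∫ s in a..b, v s) / m) := by
  set M := ∫ s in a..b, v s with hMdef
  have hm0 : (0 : ℝ) < m := by exact_mod_cast hm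
  have hI : ∀ r ∈ Set.Icc a b, ∀ s ∈ Set.Icc a b, IntervalIntegrable v volume r s :=
    fun r hr s hs => (hv.mono_set (Set.ordConnected_Icc.uIcc_subset hr hs)).intervalIntegrable
  have ha : a ∈ Set.Icc a b := ⟨le_rfl, hab⟩
  have hcont : ContinuousOn (fun s => ∫ τ in a..s, v τ) (Set.Icc a b) := by
    have := intervalIntegral.continuousOn_primitive_interval (a := a) (b := b) (f := v)
      (μ := volume) (by rwa [Set.uIcc_of_le hab])
    rwa [Set.uIcc_of_le hab] at this
  have hex : ∀ i : ℕ, ∃ y, i ≤ m → y ∈ Set.Icc a b ∧ ∫ τ in a..y, v τ = i * M / m := by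
    intro i
    by_cases hi : i ≤ m
    · have hi' : (i : ℝ) ≤ m := by exact_mod_cast hi
      have hmem : (i : ℝ) * M / m ∈ Set.Icc (∫ τ in a..a, v τ) (∫ τ in a..b, v τ) := by
        rw [intervalIntegral.integral_same, ← hMdef]
        refine ⟨by positivity, ?_⟩
        rw [div_le_iff₀ hm0, mul_comm M]
        exact mul_le_mul_of_nonneg_right hi' hM.le
      obtain ⟨y, hy, hyv⟩ := intermediate_value_Icc hab hcont hmem
      exact ⟨y, fun _ => ⟨hy, hyv⟩⟩
    · exact ⟨0, fun h => absurd h hi⟩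
  choose x hx using hex
  have hdiff : ∀ i < m, ∫ s in (x i)..(x (i + 1)), v s = M / m := by
    intro i hi
    obtain ⟨hx1, hv1⟩ := hx i hi.le
    obtain ⟨hx2, hv2⟩ := hx (i + 1) hi
    rw [← intervalIntegral.integral_interval_sub_left (hI a ha _ hx2) (hI a ha _ hx1), hv1, hv2]
    push_cast
    ring
  refine ⟨x, fun i hi => (hx i hi).1, fun i hi => ?_, hdiff⟩
  have hx1 := (hx i hi.le).1
  have hx2 := (hx (i + 1) hi).1
  have hd := hdiff i hi
  have hpos : 0 < M / m := by positivity
  have hlt : x i < x (i + 1) := by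
    by_contra! hle
    rw [intervalIntegral.integral_symm] at hd
    have := intervalIntegral.integral_nonneg (μ := volume) hle fun s _ => h0 s
    linarith
  -- A density at most `1` makes each part at least as long as its mass.
  rw [← hd]
  have := intervalIntegral.integral_mono_on hlt.le (hI _ hx1 _ hx2)
    (intervalIntegrable_const (c := (1 : ℝ))) fun s _ => h1 s
  simpa using this

/-- The derivative of the function rising linearly from `0` to `1` on `[p, q]`. -/
def rampDer (p q : ℝ) : ℝ → ℂ := (Set.Ioc p q).indicator fun _ => ((1 / (q - p) : ℝ) : ℂ)

lemma measurable_rampDer (p q : ℝ) : Measurable (rampDer p q) :=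
  measurable_const.indicator measurableSet_Ioc

lemma norm_rampDer_le {p q δ : ℝ} (hδ : 0 < δ) (h : δ ≤ q - p) (s : ℝ) :
    ‖rampDer p q s‖ ≤ 1 / δ := by
  refine (norm_indicator_le_norm_self _ _).trans ?_
  rw [Complex.norm_real, Real.norm_of_nonneg (one_div_nonneg.mpr (hδ.le.trans h))]
  exact one_div_le_one_div_of_le hδ h

lemma integral_rampDer_of_le {a p q s : ℝ} (has : a ≤ s) (h : s ≤ p) :
    ∫ τ in a..s, rampDer p q τ = 0 := by
  rw [intervalIntegral.integral_of_le has, rampDer, setIntegral_indicator measurableSet_Ioc,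
    Set.Ioc_inter_Ioc, Set.Ioc_eq_empty]
  · simp
  · exact not_lt.mpr ((min_le_left _ _).trans (h.trans (le_max_right _ _)))

lemma integral_rampDer_of_ge {a p q s : ℝ} (hap : a ≤ p) (hpq : p < q) (h : q ≤ s) :
    ∫ τ in a..s, rampDer p q τ = 1 := by
  rw [intervalIntegral.integral_of_le (hap.trans (hpq.le.trans h)), rampDer,
    setIntegral_indicator measurableSet_Ioc, Set.Ioc_inter_Ioc, max_eq_right hap, min_eq_right h,
    setIntegral_const, Real.volume_real_Ioc_of_le hpq.le, Complex.real_smul, ← Complex.ofReal_mul,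
    mul_one_div_cancel (sub_pos.mpr hpq).ne', Complex.ofReal_one]

namespace RegularTree

variable {T : RegularTree}

lemma H10_le_homH0 : T.H10 ≤ T.homH0 :=
  le_inf inf_le_right (Submodule.le_topologicalClosure _)

/-- Trapezoidal functions on an edge. -/
lemma exists_trapezoid (e : T.Edge) {x₀ x₁ x₂ x₃ δ : ℝ} (hδ : 0 < δ) (h0 : T.t e.1 ≤ x₀)
    (h01 : δ ≤ x₁ - x₀) (h12 : x₁ ≤ x₂) (h23 : δ ≤ x₃ - x₂) (h3 : x₃ ≤ T.t (e.1 + 1)) :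
    ∃ φ : T.homH0, (‖φ‖ ≤ ((T.measure {x : T.Point | x.height ≤ T.t (e.1 + 1)} ^
        (2 : ENNReal).toReal⁻¹).toReal + 1) * (2 / δ)) ∧
      (∀ s ∈ T.edgeIcc e, s ≤ x₀ → T.fn φ (T.pt e s) = 0) ∧
      (∀ s ∈ T.edgeIcc e, x₃ ≤ s → T.fn φ (T.pt e s) = 0) ∧
      (∀ s ∈ T.edgeIcc e, x₁ ≤ s → s ≤ x₂ → T.fn φ (T.pt e s) = 1) := by
  set b := T.t (e.1 + 1) with hb
  set W := rampDer x₀ x₁ - rampDer x₂ x₃ with hW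
  have hWm : Measurable W := (measurable_rampDer _ _).sub (measurable_rampDer _ _)
  have hWK : ∀ s, ‖W s‖ ≤ 2 / δ := by
    intro s
    refine (norm_sub_le _ _).trans ?_
    have := norm_rampDer_le hδ h01 s
    have := norm_rampDer_le hδ h23 s
    have h2 : 2 / δ = 1 / δ + 1 / δ := by ring
    linarith
  have hWR : ∀ s, b < s → W s = 0 := by
    intro s hs
    have hz : ∀ p q : ℝ, q ≤ b → rampDer p q s = 0 := fun p q hq =>
      Set.indicator_of_notMem (fun h => absurd h.2 (not_le.mpr (hq.trans_lt hs))) _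
    rw [hW, Pi.sub_apply, hz _ _ (by linarith), hz _ _ h3, sub_zero]
  have hint : ∀ s, ∫ τ in (T.t e.1)..s, W τ =
      (∫ τ in (T.t e.1)..s, rampDer x₀ x₁ τ) - ∫ τ in (T.t e.1)..s, rampDer x₂ x₃ τ := fun s =>
    intervalIntegral.integral_sub
      (intervalIntegrable_of_bounded (measurable_rampDer _ _) (norm_rampDer_le hδ h01) _ _)
      (intervalIntegrable_of_bounded (measurable_rampDer _ _) (norm_rampDer_le hδ h23) _ _)
  have hhigh : ∀ s, x₃ ≤ s → ∫ τ in (T.t e.1)..s, W τ = 0 := by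
    intro s hs
    rw [hint, integral_rampDer_of_ge h0 (by linarith) (by linarith),
      integral_rampDer_of_ge (by linarith) (by linarith) hs, sub_self]
  obtain ⟨u, hu, hf, hd⟩ := exists_lift_mem_H10 e hWm hWK hWR (hhigh b h3)
  have hval : ∀ s ∈ T.edgeIcc e, T.fn u (T.pt e s) = ∫ τ in (T.t e.1)..s, W τ := fun s hs => by
    rw [hf, liftFn_pt (below_self e) _ hs]
  refine ⟨⟨u, H10_le_homH0 hu⟩, ?_, ?_, ?_, ?_⟩
  · change ‖u‖ ≤ _
    rw [norm_eq_norm_der, hd, Lp.norm_toLp]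
    have h := eLpNorm_le_of_bounded (norm_liftDer_le e hWK) (liftDer_eq_zero e hWR)
    have hfin : T.measure {x : T.Point | x.height ≤ b} ^ (2 : ENNReal).toReal⁻¹ ≠ ⊤ :=
      ENNReal.rpow_ne_top_of_nonneg (by norm_num) (measure_height_le_lt_top b).ne
    have h2 := ENNReal.toReal_mono (ENNReal.mul_ne_top hfin ENNReal.ofReal_ne_top) h
    rw [ENNReal.toReal_mul, ENNReal.toReal_ofReal (by positivity)] at h2
    refine h2.trans (mul_le_mul_of_nonneg_right (by linarith) (by positivity))
  · intro s hs hs0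
    simp only
    rw [hval s hs, hint, integral_rampDer_of_le hs.1 hs0,
      integral_rampDer_of_le hs.1 (by linarith), sub_zero]
  · intro s hs hs3
    simp only
    rw [hval s hs, hhigh s hs3]
  · intro s hs hs1 hs2
    simp only
    rw [hval s hs, hint, integral_rampDer_of_ge h0 (by linarith) hs1,
      integral_rampDer_of_le hs.1 hs2, sub_zero]

lemma integrableOn_weight_pt {V : T.Point → ℝ} (hV : Integrable V T.measure) (e : T.Edge) :
    IntegrableOn (fun s => V (T.pt e s)) (T.edgeIcc e) :=
  (hV.mono_measure (T.map_pt_le_measure e)).comp_measurable (T.measurable_pt e)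

lemma exists_edge_lintegral_ne_zero {V : T.Point → ℝ} (hV : Integrable V T.measure)
    (h0 : ∀ᵐ x ∂T.measure, 0 ≤ V x) (hne : ¬ V =ᵐ[T.measure] 0) :
    ∃ e : T.Edge, ∫⁻ s in T.edgeIcc e, ENNReal.ofReal (V (T.pt e s)) ≠ 0 := by
  by_contra! hcon
  refine hne ?_
  have hm : AEMeasurable (fun x => ENNReal.ofReal (V x)) T.measure := hV.1.aemeasurable.ennreal_ofReal
  have h1 : ∫⁻ x, ENNReal.ofReal (V x) ∂T.measure = 0 := by
    rw [lintegral_measure hm, ENNReal.tsum_eq_zero]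
    exact fun n => Finset.sum_eq_zero fun c _ => hcon ⟨n, c⟩
  rw [lintegral_eq_zero_iff' hm] at h1
  filter_upwards [h1, h0] with x hx hx0
  exact le_antisymm (ENNReal.ofReal_eq_zero.mp hx) hx0

lemma setIntegral_weight_pt_le {V : T.Point → ℝ} (h0 : ∀ᵐ x ∂T.measure, 0 ≤ V x)
    (u : T.DirichletSpace) (hu : Integrable (fun x => V x * ‖T.fn u x‖ ^ 2) T.measure)
    (e : T.Edge) :
    ∫ s in T.edgeIcc e, V (T.pt e s) * ‖T.fn u (T.pt e s)‖ ^ 2 ≤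
      ∫ x, V x * ‖T.fn u x‖ ^ 2 ∂T.measure := by
  have h1 := integral_map (T.measurable_pt e).aemeasurable
    (hu.1.mono_measure (T.map_pt_le_measure e))
  rw [← h1]
  refine integral_mono_measure (T.map_pt_le_measure e) ?_ hu
  filter_upwards [h0] with x hx
  exact mul_nonneg hx (by positivity)

/-- A polynomial lower bound for the singular numbers of the form operator of a nonzero weight. -/
lemma IsFormOperator.exists_le_singularNumber {V : T.Point → ℝ} (hV : Integrable V T.measure)
    (h0 : ∀ᵐ x ∂T.measure, 0 ≤ V x) (hne : ¬ V =ᵐ[T.measure] 0) {A : T.homH0 →L[ℂ] T.homH0}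
    (hA : T.IsFormOperator V A) :
    ∃ c, 0 < c ∧ ∀ n : ℕ, c ≤ ((n : ℝ) + 1) ^ 4 * singularNumber A n := by
  obtain ⟨e, he⟩ := exists_edge_lintegral_ne_zero hV h0 hne
  set a := T.t e.1 with ha
  set b := T.t (e.1 + 1) with hb
  have hab : a < b := T.t_lt_succ e.1
  -- Truncation at `1` makes parts of equal mass long enough for the ramps to have controlled slope;
  -- it does not destroy positivity of the mass.
  set v : ℝ → ℝ := fun s => max 0 (min (V (T.pt e s)) 1) with hv
  have hv0 : ∀ s, 0 ≤ v s := fun s => le_max_left _ _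
  have hv1 : ∀ s, v s ≤ 1 := fun s => max_le zero_le_one (min_le_right _ _)
  have hVe := integrableOn_weight_pt hV e
  have hVpos := T.ae_pt e h0
  have hvi : IntegrableOn v (Set.Icc a b) := by
    have hm : AEStronglyMeasurable v (volume.restrict (Set.Icc a b)) :=
      aestronglyMeasurable_const.sup (hVe.1.inf aestronglyMeasurable_const)
    refine Integrable.mono' (g := fun _ => (1 : ℝ)) (by simp) hm
      (Eventually.of_forall fun s => ?_)
    rw [Real.norm_of_nonneg (hv0 s)]
    exact hv1 s
  set M := ∫ s in a..b, v s with hMdef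
  have hM : 0 < M := by
    refine lt_of_le_of_ne (intervalIntegral.integral_nonneg hab.le fun s _ => hv0 s) fun hM0 => he ?_
    rw [hMdef, intervalIntegral.integral_of_le hab.le, ← integral_Icc_eq_integral_Ioc, eq_comm,
      setIntegral_eq_zero_iff_of_nonneg_ae (Eventually.of_forall hv0) hvi] at hM0
    refine (lintegral_congr_ae (g := fun _ => 0) ?_).trans lintegral_zero
    filter_upwards [hM0] with s hs
    rw [ENNReal.ofReal_eq_zero]
    by_contra! hlt
    have h2 : 0 < v s := lt_max_of_lt_right (lt_min hlt zero_lt_one)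
    exact h2.ne' hs
  set B := (T.measure {x : T.Point | x.height ≤ b} ^ (2 : ENNReal).toReal⁻¹).toReal + 1 with hB
  have hB0 : 0 < B := by positivity
  -- The test space gives the bound `δ³ / (4 B² (n + 1))` with `δ = M / m` and `m ≤ 3 (n + 1)`; here
  -- `108 = 4 * 27`.
  refine ⟨M ^ 3 / (108 * B ^ 2), by positivity, fun n => ?_⟩
  have hn0 : (0 : ℝ) < (n : ℝ) + 1 := by positivity
  rw [← div_le_iff₀' (by positivity)]
  -- The trapezoid with index `j` occupies three consecutive parts, from `x (2j)` to `x (2j + 3)`.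
  -- Neighbours overlap only along ramps, so each plateau is met by one function only; the last
  -- index `j = n` ends at `x m`.
  set m := 2 * n + 3 with hm
  have hm0 : (0 : ℝ) < m := by rw [hm]; positivity
  obtain ⟨x, hxmem, hxd, hxint⟩ := exists_equal_mass_points hab.le hvi hv0 hv1 hM
    (show 0 < m by omega)
  rw [← hMdef] at hxd hxint
  set δ := M / m with hδdef
  have hδ : 0 < δ := by positivity
  have hmono : ∀ i j, i ≤ j → j ≤ m → x i ≤ x j := by
    intro i j hij
    induction j, hij using Nat.le_induction with
    | base => exact fun _ => le_rfl
    | succ j hij ih =>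
      intro hj
      have h1 := ih (by omega)
      have h2 := hxd j (by omega)
      linarith
  have hφ : ∀ j : Fin (n + 1), ∃ φ : T.homH0, ‖φ‖ ≤ B * (2 / δ) ∧
      (∀ s ∈ T.edgeIcc e, s ≤ x (2 * j) → T.fn φ (T.pt e s) = 0) ∧
      (∀ s ∈ T.edgeIcc e, x (2 * j + 3) ≤ s → T.fn φ (T.pt e s) = 0) ∧
      (∀ s ∈ T.edgeIcc e, x (2 * j + 1) ≤ s → s ≤ x (2 * j + 2) → T.fn φ (T.pt e s) = 1) := by
    intro j
    have hj := j.2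
    exact exists_trapezoid e hδ (hxmem _ (by omega)).1 (hxd _ (by omega))
      (hmono _ _ (by omega) (by omega)) (hxd _ (by omega)) (hxmem _ (by omega)).2
  choose φ hφn hφl hφr hφ1 using hφ
  set I : Fin (n + 1) → Set ℝ := fun j => Set.Ioc (x (2 * j + 1)) (x (2 * j + 2)) with hI
  have hIsub : ∀ j, I j ⊆ T.edgeIcc e := fun j s hs =>
    ⟨(hxmem (2 * j + 1) (by omega)).1.trans hs.1.le, hs.2.trans (hxmem (2 * j + 2) (by omega)).2⟩
  have hφI : ∀ i j, ∀ s ∈ I i, T.fn (φ j) (T.pt e s) = if j = i then 1 else 0 := by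
    intro i j s hs
    have hsI := hIsub i hs
    rcases lt_trichotomy i j with h | h | h
    · rw [if_neg h.ne']
      have h' : (i : ℕ) < j := h
      exact hφl j s hsI (hs.2.trans (hmono _ _ (by omega) (by omega)))
    · rw [if_pos h.symm, ← h]
      exact hφ1 i s hsI hs.1.le hs.2
    · rw [if_neg h.ne]
      have h' : (j : ℕ) < i := h
      exact hφr j s hsI ((hmono _ _ (by omega) (by omega)).trans hs.1.le)
  set L := Fintype.linearCombination ℂ φ with hL
  have hLfn : ∀ c y, T.fn (L c) y = ∑ j, c j * T.fn (φ j) y := by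
    intro c y
    rw [hL, Fintype.linearCombination_apply, Submodule.coe_sum, map_sum, Finset.sum_apply]
    rfl
  refine le_singularNumber_of_testSpace (L := L) (q := fun c => ∑ j, ‖c j‖ ^ 2)
    (a := δ) (b := ((n : ℝ) + 1) * (B * (2 / δ)) ^ 2) (by positivity) ?_ ?_ ?_ ?_
  · intro c hc
    obtain ⟨j, hj⟩ := Function.ne_iff.mp hc
    refine Finset.sum_pos' (fun _ _ => by positivity) ⟨j, Finset.mem_univ _, ?_⟩
    have : 0 < ‖c j‖ := norm_pos_iff.mpr hj
    positivity
  · intro c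
    obtain ⟨hint, hval⟩ := hA (L c)
    rw [hval, Complex.norm_real]
    refine le_trans ?_ (le_abs_self _)
    refine le_trans ?_ (setIntegral_weight_pt_le h0 _ hint e)
    have hvI : ∀ j, IntegrableOn ((I j).indicator v) (T.edgeIcc e) := fun j =>
      Integrable.indicator hvi measurableSet_Ioc
    have hsum : δ * ∑ j, ‖c j‖ ^ 2 =
        ∫ s in T.edgeIcc e, ∑ j, ‖c j‖ ^ 2 * (I j).indicator v s := by
      rw [integral_finsetSum _ fun j _ => (hvI j).const_mul _, Finset.mul_sum]
      refine Finset.sum_congr rfl fun j _ => ?_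
      rw [integral_const_mul, setIntegral_indicator measurableSet_Ioc,
        Set.inter_eq_self_of_subset_right (hIsub j),
        ← intervalIntegral.integral_of_le (hmono _ _ (by omega) (by omega)),
        hxint _ (by omega), mul_comm]
    rw [hsum]
    refine integral_mono_ae (integrable_finsetSum _ fun j _ => (hvI j).const_mul _) ?_ ?_
    · exact (hint.mono_measure (T.map_pt_le_measure e)).comp_measurable (T.measurable_pt e)
    · filter_upwards [hVpos] with s hs
      by_cases hex : ∃ i, s ∈ I i
      · obtain ⟨i, hi⟩ := hex
        have h1 : T.fn (L c) (T.pt e s) = c i := by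
          rw [hLfn, Finset.sum_congr rfl fun j _ => by rw [hφI i j s hi]]
          simp
        -- On a plateau both sums reduce to one term; elsewhere the lower bound is zero and only
        -- nonnegativity of the weight is needed.
        have h2 : ∑ j, ‖c j‖ ^ 2 * (I j).indicator v s = ‖c i‖ ^ 2 * v s := by
          rw [Finset.sum_eq_single i, Set.indicator_of_mem hi]
          · intro j _ hji
            rw [Set.indicator_of_notMem, mul_zero]
            intro hj
            have h3 := hφI i j s hi
            rw [hφI j j s hj, if_pos rfl, if_neg hji] at h3
            exact one_ne_zero h3
          · exact fun h => absurd (Finset.mem_univ _) h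
        simp only [h1, h2]
        rw [mul_comm]
        refine mul_le_mul_of_nonneg_right ?_ (by positivity)
        exact max_le hs (min_le_left _ _)
      · push Not at hex
        have h2 : ∑ j, ‖c j‖ ^ 2 * (I j).indicator v s = 0 :=
          Finset.sum_eq_zero fun j _ => by rw [Set.indicator_of_notMem (hex j), mul_zero]
        simp only [h2]
        exact mul_nonneg hs (by positivity)
  · intro c
    have h1 : ‖L c‖ ≤ ∑ j, ‖c j‖ * (B * (2 / δ)) := by
      rw [hL, Fintype.linearCombination_apply]
      refine (norm_sum_le _ _).trans (Finset.sum_le_sum fun j _ => ?_)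
      rw [norm_smul]
      exact mul_le_mul_of_nonneg_left (hφn j) (norm_nonneg _)
    have h2 : (∑ j, ‖c j‖) ^ 2 ≤ ((n : ℝ) + 1) * ∑ j, ‖c j‖ ^ 2 := by
      have := sq_sum_le_card_mul_sum_sq (s := (Finset.univ : Finset (Fin (n + 1))))
        (f := fun j => ‖c j‖)
      simpa using this
    rw [← Finset.sum_mul] at h1
    calc ‖L c‖ ^ 2 ≤ ((∑ j, ‖c j‖) * (B * (2 / δ))) ^ 2 := pow_le_pow_left₀ (norm_nonneg _) h1 2
      _ = (∑ j, ‖c j‖) ^ 2 * (B * (2 / δ)) ^ 2 := mul_pow _ _ _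
      _ ≤ (((n : ℝ) + 1) * ∑ j, ‖c j‖ ^ 2) * (B * (2 / δ)) ^ 2 :=
          mul_le_mul_of_nonneg_right h2 (by positivity)
      _ = _ := by ring
  · have hm3 : (m : ℝ) ≤ 3 * ((n : ℝ) + 1) := by
      rw [hm]; push_cast; linarith [(Nat.cast_nonneg n : (0 : ℝ) ≤ n)]
    have hcube : (m : ℝ) ^ 3 ≤ 27 * ((n : ℝ) + 1) ^ 3 := by
      calc (m : ℝ) ^ 3 ≤ (3 * ((n : ℝ) + 1)) ^ 3 := pow_le_pow_left₀ hm0.le hm3 3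
        _ = _ := by ring
    have h1 : M ^ 3 / (108 * B ^ 2) / ((n : ℝ) + 1) ^ 4 * (((n : ℝ) + 1) * (B * (2 / δ)) ^ 2) =
        δ * ((m : ℝ) ^ 3 / (27 * ((n : ℝ) + 1) ^ 3)) := by
      rw [hδdef]
      field_simp
      ring
    rw [h1]
    exact mul_le_of_le_one_right hδ.le (div_le_one_of_le₀ hcube (by positivity))

/-! ### The form on the full space and comparison of singular numbers -/

lemma IsFormOperator.integral_le {V : T.Point → ℝ} {S : Submodule ℂ T.DirichletSpace}
    {A : S →L[ℂ] S} (hA : T.IsFormOperator V A) (u : S) :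
    ∫ x, V x * ‖T.fn u x‖ ^ 2 ∂T.measure ≤ ‖A‖ * ‖u‖ ^ 2 := by
  have h1 := norm_inner_sub_le A 0 (u := u) rfl
  rw [(hA u).2, Complex.norm_real, sub_zero] at h1
  exact (le_abs_self _).trans h1

/-- The bound of the form on `𝓗(Γ)`, relative to the norm of the operator on `𝓗°(Γ)`. -/
def formConst (l t : ℝ) : ℝ := 2 * (1 + √l * √(1 / t)) ^ 2 + 2 * (l / t)

lemma one_le_formConst {l t : ℝ} (hl : 0 ≤ l) (ht : 0 < t) : 1 ≤ formConst l t := by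
  have h1 : 0 ≤ √l * √(1 / t) := by positivity
  have h2 : 0 ≤ l / t := by positivity
  unfold formConst
  nlinarith

lemma IsFormOperator.form_le (hI : IntegrableOn (fun s => 1 / T.g₀ s) (Set.Ioi 0))
    {V : T.Point → ℝ} (hV : Integrable V T.measure) (h0 : ∀ᵐ x ∂T.measure, 0 ≤ V x)
    {A : T.homH0 →L[ℂ] T.homH0} (hA : T.IsFormOperator V A) {u : T.DirichletSpace}
    (hu : u ∈ T.homH) :
    Integrable (fun x => V x * ‖T.fn u x‖ ^ 2) T.measure ∧
      ∫ x, V x * ‖T.fn u x‖ ^ 2 ∂T.measure ≤ formConst T.reducedHeight (T.t 1) *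
        (‖A‖ + T.t 1 * ∫ x in T.rootEdge, V x ∂T.measure) * ‖u‖ ^ 2 := by
  obtain ⟨η, hη, hη1, hηb, hηz, hηn⟩ := T.exists_rootFn
  have ht := T.t_one_pos
  have hl := T.reducedHeight_nonneg
  set l := T.reducedHeight with hldef
  have hmE : MeasurableSet T.rootEdge := measurable_height measurableSet_Iic
  set z := T.fn u T.root with hz
  -- Split `u = u₀ + z η`: the form of `u₀` is governed by `A`, that of `z η` by the weight on the
  -- root edge.
  set u₀ : T.homH0 := ⟨u - z • η, sub_smul_mem_homH0 hη hη1 hu⟩ with hu₀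
  have hzn : ‖z‖ ≤ √l * ‖u‖ := norm_fn_root_le_of_mem_homH hI hu
  have hu₀n : ‖u₀‖ ≤ (1 + √l * √(1 / T.t 1)) * ‖u‖ := by
    have h1 : ‖u₀‖ ≤ ‖u‖ + ‖z • η‖ := norm_sub_le u (z • η)
    have h2 : ‖η‖ ≤ √(1 / T.t 1) := Real.le_sqrt_of_sq_le hηn
    rw [norm_smul] at h1
    have h3 : ‖z‖ * ‖η‖ ≤ (√l * ‖u‖) * √(1 / T.t 1) :=
      mul_le_mul hzn h2 (norm_nonneg _) (by positivity)
    linarith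
  obtain ⟨hint₀, -⟩ := hA u₀
  have hle₀ := hA.integral_le u₀
  have hintE : Integrable (T.rootEdge.indicator V) T.measure := hV.indicator hmE
  set g : T.Point → ℝ := fun x => 2 * (V x * ‖T.fn u₀ x‖ ^ 2) +
    2 * ‖z‖ ^ 2 * T.rootEdge.indicator V x with hg
  have hgi : Integrable g T.measure := (hint₀.const_mul 2).add (hintE.const_mul _)
  have hpt : ∀ᵐ x ∂T.measure, V x * ‖T.fn u x‖ ^ 2 ≤ g x := by
    filter_upwards [h0] with x hx
    have h1 : T.fn u x = T.fn u₀ x + z * T.fn η x := by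
      simp [hu₀]
    have h2 : ‖T.fn u x‖ ^ 2 ≤ 2 * ‖T.fn u₀ x‖ ^ 2 + 2 * (‖z‖ ^ 2 * ‖T.fn η x‖ ^ 2) := by
      have h3 := norm_add_le (T.fn u₀ x) (z * T.fn η x)
      rw [← h1, norm_mul] at h3
      have h4 := pow_le_pow_left₀ (norm_nonneg _) h3 2
      nlinarith [sq_nonneg (‖T.fn u₀ x‖ - ‖z‖ * ‖T.fn η x‖)]
    have h3 : V x * ‖T.fn η x‖ ^ 2 ≤ T.rootEdge.indicator V x := by
      by_cases hxE : x ∈ T.rootEdge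
      · rw [Set.indicator_of_mem hxE]
        exact mul_le_of_le_one_right hx (pow_le_one₀ (norm_nonneg _) (hηb x))
      · rw [Set.indicator_of_notMem hxE, hηz x hxE]
        simp
    have h4 := mul_le_mul_of_nonneg_left h2 hx
    have h5 := mul_le_mul_of_nonneg_left h3 (show 0 ≤ 2 * ‖z‖ ^ 2 by positivity)
    simp only [hg]
    linarith
  have hint : Integrable (fun x => V x * ‖T.fn u x‖ ^ 2) T.measure := by
    refine hgi.mono' (hV.1.mul
      ((measurable_fn u).norm.pow_const 2).aestronglyMeasurable) ?_
    filter_upwards [hpt, h0] with x hx hx0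
    rwa [Real.norm_of_nonneg (mul_nonneg hx0 (by positivity))]
  refine ⟨hint, (integral_mono_ae hint hgi hpt).trans ?_⟩
  rw [hg, integral_add (hint₀.const_mul 2) (hintE.const_mul _), integral_const_mul,
    integral_const_mul, integral_indicator hmE]
  set E := ∫ x in T.rootEdge, V x ∂T.measure with hE
  have hE0 : 0 ≤ E := integral_nonneg_of_ae (ae_restrict_of_ae h0)
  have h1 : ‖A‖ * ‖u₀‖ ^ 2 ≤ ‖A‖ * ((1 + √l * √(1 / T.t 1)) ^ 2 * ‖u‖ ^ 2) := by
    rw [← mul_pow]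
    exact mul_le_mul_of_nonneg_left (pow_le_pow_left₀ (norm_nonneg _) hu₀n 2)
      A.opNorm_nonneg
  have h2 : ‖z‖ ^ 2 * E ≤ l * ‖u‖ ^ 2 * E := by
    refine mul_le_mul_of_nonneg_right ?_ hE0
    have := pow_le_pow_left₀ (norm_nonneg _) hzn 2
    rwa [mul_pow, Real.sq_sqrt hl] at this
  -- Using one constant for both summands leaves nonnegative cross terms, which are discarded. The
  -- summand `l / t₁` compensates for the factor `t₁` in front of the edge integral.
  have h3 : formConst l (T.t 1) * (‖A‖ + T.t 1 * E) * ‖u‖ ^ 2 =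
      2 * (‖A‖ * ((1 + √l * √(1 / T.t 1)) ^ 2 * ‖u‖ ^ 2)) + 2 * (l * ‖u‖ ^ 2 * E) +
      (2 * (1 + √l * √(1 / T.t 1)) ^ 2 * (T.t 1 * E) + 2 * (l / T.t 1) * ‖A‖) * ‖u‖ ^ 2 := by
    unfold formConst
    field_simp
    ring
  have h4 : 0 ≤ (2 * (1 + √l * √(1 / T.t 1)) ^ 2 * (T.t 1 * E) + 2 * (l / T.t 1) * ‖A‖) *
      ‖u‖ ^ 2 := by positivity
  rw [h3]
  linarith

/-- A bounded nonnegative form `∫ V |u|² dx` is the square of the norm of `√V u`. -/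
lemma exists_sqrt_weight_mul {V : T.Point → ℝ} (hV : Integrable V T.measure)
    (h0 : ∀ᵐ x ∂T.measure, 0 ≤ V x) {S : Submodule ℂ T.DirichletSpace} {c : ℝ} (hc : 0 ≤ c)
    (hS : ∀ u ∈ S, Integrable (fun x => V x * ‖T.fn u x‖ ^ 2) T.measure ∧
      ∫ x, V x * ‖T.fn u x‖ ^ 2 ∂T.measure ≤ c * ‖u‖ ^ 2) :
    ∃ J : S →L[ℂ] Lp ℂ 2 T.measure, ‖J‖ ^ 2 ≤ c ∧
      ∀ u, ‖J u‖ ^ 2 = ∫ x, V x * ‖T.fn u x‖ ^ 2 ∂T.measure := by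
  set f : T.DirichletSpace → T.Point → ℂ := fun u x => ((√(V x) : ℝ) : ℂ) * T.fn u x with hf
  have hfsq : ∀ u, ∀ᵐ x ∂T.measure, ‖f u x‖ ^ 2 = V x * ‖T.fn u x‖ ^ 2 := by
    intro u
    filter_upwards [h0] with x hx
    rw [hf, norm_mul, mul_pow, Complex.norm_real, Real.norm_of_nonneg (Real.sqrt_nonneg _),
      Real.sq_sqrt hx]
  have hmem : ∀ u ∈ S, MemLp (f u) 2 T.measure := by
    intro u hu
    have hm : AEStronglyMeasurable (f u) T.measure := by
      refine AEStronglyMeasurable.mul ?_ (measurable_fn u).aestronglyMeasurable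
      exact (Complex.measurable_ofReal.comp_aemeasurable
        (Real.continuous_sqrt.measurable.comp_aemeasurable hV.1.aemeasurable)).aestronglyMeasurable
    rw [memLp_two_iff_integrable_sq_norm hm]
    exact (hS u hu).1.congr ((hfsq u).mono fun x hx => hx.symm)
  let J₀ : S →ₗ[ℂ] Lp ℂ 2 T.measure :=
    { toFun := fun u => (hmem u u.2).toLp (f u)
      map_add' := fun u v => by
        rw [← MemLp.toLp_add]
        congr 1
        funext x
        simp [hf, mul_add]
      map_smul' := fun a u => by
        rw [RingHom.id_apply, ← MemLp.toLp_const_smul]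
        congr 1
        funext x
        simp [hf, mul_left_comm] }
  have hnorm : ∀ u, ‖J₀ u‖ ^ 2 = ∫ x, V x * ‖T.fn u x‖ ^ 2 ∂T.measure := by
    intro u
    have hpos : 0 ≤ᵐ[T.measure] fun x => V x * ‖T.fn u x‖ ^ 2 :=
      h0.mono fun x hx => mul_nonneg hx (by positivity)
    rw [← ENNReal.ofReal_eq_ofReal_iff (by positivity) (integral_nonneg_of_ae hpos),
      ofReal_norm_sq_Lp, ofReal_integral_eq_lintegral_ofReal (hS u u.2).1 hpos]
    refine lintegral_congr_ae ?_
    filter_upwards [(hmem u u.2).coeFn_toLp, hfsq u] with x hx hx2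
    rw [← hx2, ENNReal.ofReal_pow (norm_nonneg _), ofReal_norm]
    exact congrArg (fun y : ℂ => ‖y‖ₑ ^ 2) hx
  have hbd : ∀ u, ‖J₀ u‖ ≤ √c * ‖u‖ := by
    intro u
    refine le_of_sq_le_sq ?_ (by positivity)
    rw [hnorm, mul_pow, Real.sq_sqrt hc]
    exact (hS u u.2).2
  refine ⟨J₀.mkContinuous (√c) hbd, ?_, hnorm⟩
  have h1 := J₀.mkContinuous_norm_le (Real.sqrt_nonneg c) hbd
  exact (pow_le_pow_left₀ (ContinuousLinearMap.opNorm_nonneg _) h1 2).trans_eq (Real.sq_sqrt hc)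

/-- The space `𝓗°(Γ)` has codimension one in `𝓗(Γ)`, so that the singular numbers of the form
operators are compared after a shift by one. -/
lemma IsFormOperator.singularNumber_succ_le {V : T.Point → ℝ} {A : T.homH0 →L[ℂ] T.homH0}
    (hA : T.IsFormOperator V A) {A' : T.homH →L[ℂ] T.homH} {J : T.homH →L[ℂ] Lp ℂ 2 T.measure}
    (hJ : ∀ u, ‖J u‖ ^ 2 = ∫ x, V x * ‖T.fn u x‖ ^ 2 ∂T.measure)
    (hA' : ∀ (X : Type) [AddCommGroup X] [Module ℂ X] (Φ : T.homH →ₗ[ℂ] X) (m : ℕ),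
      Module.Finite ℂ Φ.range → Module.finrank ℂ Φ.range ≤ m → ∀ σ : ℝ, 0 ≤ σ →
      (∀ u, Φ u = 0 → ‖J u‖ ^ 2 ≤ σ * ‖u‖ ^ 2) → singularNumber A' m ≤ σ) (n : ℕ) :
    singularNumber A' (n + 1) ≤ singularNumber A n := by
  obtain ⟨η, hη, hη1, -⟩ := T.exists_rootFn
  refine le_singularNumber fun F hF => ?_
  let ev : T.homH →ₗ[ℂ] ℂ := ((LinearMap.proj T.root).comp T.fn).comp T.homH.subtype
  let π : T.homH →ₗ[ℂ] T.homH0 := LinearMap.codRestrict T.homH0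
    (T.homH.subtype - ev.smulRight η) fun u => sub_smul_mem_homH0 hη hη1 u.2
  -- On `ker Φ` the root value vanishes, so `π u = u` lies in `homH0` and is annihilated by `F`; the
  -- evaluation accounts for the one extra rank.
  let Φ : T.homH →ₗ[ℂ] T.homH0 × ℂ :=
    (LinearMap.inl ℂ T.homH0 ℂ).comp ((F : T.homH0 →ₗ[ℂ] T.homH0).comp π) +
      (LinearMap.inr ℂ T.homH0 ℂ).comp ev
  have hΦ : Φ.rank ≤ ((n + 1 : ℕ) : Cardinal) := by
    rw [Nat.cast_add]
    refine (LinearMap.rank_add_le _ _).trans (add_le_add ?_ ?_)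
    · exact ((LinearMap.rank_comp_le_right _ _).trans (LinearMap.rank_comp_le_left _ _)).trans hF
    · refine (LinearMap.rank_comp_le_right _ _).trans ((LinearMap.rank_le_range ev).trans ?_)
      simp
  have hfin : Module.Finite ℂ Φ.range :=
    Module.rank_lt_aleph0_iff.mp (lt_of_le_of_lt hΦ Cardinal.natCast_lt_aleph0)
  refine hA' _ Φ (n + 1) hfin ?_ _ (A - F).opNorm_nonneg fun u hu => ?_
  · have h1 : Module.rank ℂ Φ.range ≤ ((n + 1 : ℕ) : Cardinal) := hΦ
    rw [← Module.finrank_eq_rank] at h1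
    exact_mod_cast h1
  · have h1 : F (π u) = 0 := by simpa [Φ] using congrArg Prod.fst hu
    have h2 : T.fn u T.root = 0 := by simpa [Φ, ev] using congrArg Prod.snd hu
    have h3 : ((π u : T.homH0) : T.DirichletSpace) = u := by
      change (u : T.DirichletSpace) - T.fn u T.root • η = u
      rw [h2, zero_smul, sub_zero]
    have h4 := norm_inner_sub_le A F h1
    rw [(hA (π u)).2, Complex.norm_real] at h4
    have h5 : ‖π u‖ = ‖u‖ := by
      rw [← Submodule.norm_coe, ← Submodule.norm_coe, h3]
    rw [h5, h3] at h4
    rw [hJ]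
    exact (le_abs_self _).trans h4

end RegularTree

end

/-! ### Assembly of the estimates -/

theorem theoremN :
    ∃ C : ℝ → ℝ → ℝ,
      ∀ T : RegularTree, T.IsTransient →
      ∀ V : T.Point → ℝ, Integrable V T.measure → (∀ᵐ x ∂T.measure, 0 ≤ V x) →
      ∀ A : T.homH0 →L[ℂ] T.homH0, T.IsFormOperator V A →
      ∃ A' : T.homH →L[ℂ] T.homH, T.IsFormOperator V A' ∧
        ∀ p : ℝ, 0 < p →
          (MemSchatten p A → MemSchatten p A' ∧
            schattenNorm p A' ≤ C T.reducedHeight (T.t 1) *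
              (schattenNorm p A + T.t 1 * ∫ x in T.rootEdge, V x ∂T.measure)) ∧
          (MemWeakSchatten p A → MemWeakSchatten p A' ∧
            weakSchattenNorm p A' ≤ C T.reducedHeight (T.t 1) *
              (weakSchattenNorm p A + T.t 1 * ∫ x in T.rootEdge, V x ∂T.measure)) ∧
          (MemWeakSchattenZero p A → MemWeakSchattenZero p A' ∧
            weakSchattenNorm p A' ≤ C T.reducedHeight (T.t 1) *
              (weakSchattenNorm p A + T.t 1 * ∫ x in T.rootEdge, V x ∂T.measure)) := by
  -- The factor `16` bounds `2 ^ (1 / p)` for `p ≥ 1/4`.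
  refine ⟨fun l t => 16 * RegularTree.formConst l t, fun T hT V hV h0 A hA => ?_⟩
  have hI := hT.integrableOn
  have hC := RegularTree.one_le_formConst T.reducedHeight_nonneg T.t_one_pos
  set C := RegularTree.formConst T.reducedHeight (T.t 1) with hCdef
  set X := T.t 1 * ∫ x in T.rootEdge, V x ∂T.measure with hX
  have hX0 : 0 ≤ X :=
    mul_nonneg T.t_one_pos.le (integral_nonneg_of_ae (ae_restrict_of_ae h0))
  have hsep := RegularTree.eq_zero_of_norm_eq_zero hI
  have hcs := RegularTree.completeSpace_homH hI
  have hform := fun u (hu : u ∈ T.homH) => hA.form_le hI hV h0 hu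
  obtain ⟨J, hJn, hJ⟩ := RegularTree.exists_sqrt_weight_mul hV h0
    (mul_nonneg (zero_le_one.trans hC) (add_nonneg (norm_nonneg A) hX0)) hform
  obtain ⟨A', hA'J, hA'n, hA's, hA'c⟩ := exists_adjoint_comp_self hsep J
  refine ⟨A', fun u => ⟨(hform u u.2).1, by rw [hA'J, hJ]⟩, fun p hp => ?_⟩
  refine class_estimates hC hX0 (hA.singularNumber_succ_le hJ hA's) ?_ hA'c ?_ hp
  · refine (singularNumber_le_norm _ _).trans ((hA'n.trans hJn).trans ?_)
    exact mul_le_mul_of_nonneg_left (add_le_add_left (norm_le_singularNumber_zero A) X)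
      (zero_le_one.trans hC)
  -- With zero weight no lower bound is available, and no restriction on `p` follows; but then `J =
  -- 0`, so `A'` vanishes because the seminorm separates points of `homH`.
  · by_cases hne : V =ᵐ[T.measure] 0
    · left
      have hJ0 : J = 0 := by
        ext1 u
        have h1 : ‖J u‖ ^ 2 = 0 := by
          rw [hJ, integral_eq_zero_of_ae]
          filter_upwards [hne] with x hx
          simp [hx]
        simpa using h1
      have hn0 : ‖A'‖ ≤ 0 := by
        rw [hJ0, ContinuousLinearMap.opNorm_zero] at hA'n
        simpa using hA'n
      ext1 u
      refine hsep _ (le_antisymm ?_ (norm_nonneg _))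
      exact (A'.le_opNorm u).trans (mul_nonpos_of_nonpos_of_nonneg hn0 (norm_nonneg _))
    · exact Or.inr (hA.exists_le_singularNumber hV h0 hne)
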